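/- Let $r\ge 0$ be an integer and $N=\mathbb Z^r$. A fan on $N\otimes\mathbb R=\mathbb R^r$ means a finite nonempty set $\Delta$ of strongly convex rational polyhedral cones, closed under taking faces, such that any two cones of $\Delta$ intersect in a common face. Let $|\Delta|$ be the union of the cones of $\Delta$, $s=\dim_{\mathbb R}\mathbb R|\Delta|$ the dimension of the vector space spanned by $|\Delta|$, and $\Delta(1)$ the set of one-dimensional cones of $\Delta$. Let $\Delta_{top}$ be the finite set $\Delta$ with the topology whose open sets are the subsets of $\Delta$ closed under taking faces. For a field $k$ let $X$ be the toric variety of $\Delta$ over $k$, obtained by gluing the affine schemes $\operatorname{Spec} k[\sigma^\vee\cap\operatorname{Hom}(N,\mathbb Z)]$, $\sigma\in\Delta$. Put $$\rho_0=\dim_{\mathbb Q}\bigl[(H^0(X_{\text{ét}},\mathbb G_m)/k^*)\otimes\mathbb Q\bigr],\qquad \rho_1'=\dim_{\mathbb Q}\bigl[\operatorname{Cl}(X)\otimes\mathbb Q\bigr],$$ where $\operatorname{Cl}(X)$ is the group of Weil divisors modulo principal divisors. A number $\beta(\Delta)$ attached to every fan on $\mathbb Z^r\otimes\mathbb R$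 ($r$ fixed) is called a topological invariant of a given fan $\Delta$ if $\beta(\Delta')=\beta(\Delta)$ for every fan $\Delta'$ on $\mathbb Z^r\otimes\mathbb R$ with $\Delta'_{top}$ homeomorphic to $\Delta_{top}$, and a topological invariant if this holds for every fan $\Delta$ on $\mathbb Z^r\otimes\mathbb R$. Then: (a) For every fan $\Delta$, $\rho_0$ is finite and $\rho_0=r-s$. Hence $\rho_0$ is a fan invariant, that is, it is the same for any two fields $k$, $k'$. If $r\ge 2$, then $\rho_0$ is not a topological invariant. (b) Every complete fan $\Delta$ (that is, $|\Delta|=\mathbb R^r$) contains a cone of dimension $r$. If $\Delta$ contains a cone of dimension $r$, then $\rho_0=0$ and $\rho_0$ is a topological invariant of $\Delta$. (c) For every fan $\Delta$, $\rho_1'$ is finite and $\rho_1'=\#\Delta(1)-s$. If the Krull dimension of $\Delta_{top}$ is $r$, then $\rho_1'$ is a topological invariant of $\Delta$. (d) For every fan $\Delta$, $\rho_0-\rho_1'=r-\#\Delta(1)$, and $\rho_0-\rho_1'$ is a topological invariant. -/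

import Mathlib

open CategoryTheory Limits AlgebraicGeometry Opposite
open scoped TensorProduct

universe u v

/-! ### Rational cones and fans in `N ⊗ ℝ`, for `N = ℤ ^ r` -/
/-! ### The étale sheaf of units, and the class group of Weil divisors, of a scheme -/

namespace ToricFan

section EtaleUnits

/-- The presheaf of abelian groups `U ↦ Γ(U, O_U)ˣ` on the category of schemes, written additively. -/
noncomputable def unitsPresheaf : Scheme.{u}ᵒᵖ ⥤ Ab.{u} :=
  Scheme.Γ ⋙ forget₂ CommRingCat CommMonCat ⋙ CommMonCat.units ⋙ CommGrpCat.toAddCommGrp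

theorem etaleTopology_subcanonical : Scheme.etaleTopology.{u}.Subcanonical :=
  .of_le (Scheme.etaleTopology_le_proetaleTopology.trans Scheme.proetaleTopology_le_fpqcTopology)

theorem isSheaf_Γ : Presheaf.IsSheaf Scheme.etaleTopology.{u} Scheme.Γ.{u} := by
  intro E
  have := etaleTopology_subcanonical.{u}
  have e : yoneda.obj (Spec E) ≅ Scheme.Γ.{u} ⋙ coyoneda.obj (op E) :=
    NatIso.ofComponents
      (fun U => (((ΓSpec.adjunction.homEquiv U.unop (op E)).symm.trans
        (opEquiv _ _)).toIso)) (fun {U V} f => by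
          ext g
          change ((ΓSpec.adjunction.homEquiv V.unop (op E)).symm (f.unop ≫ g)).unop =
            ((ΓSpec.adjunction.homEquiv U.unop (op E)).symm g).unop ≫ Scheme.Γ.map f
          rw [Adjunction.homEquiv_naturality_left_symm]
          rfl)
  refine Presieve.isSheaf_iso _ e ?_
  exact GrothendieckTopology.Subcanonical.isSheaf_of_isRepresentable _

theorem isSheaf_unitsPresheaf : Presheaf.IsSheaf Scheme.etaleTopology.{u} unitsPresheaf.{u} := by
  have : CommGrpCat.toAddCommGrp.{u}.IsEquivalence :=
    inferInstanceAs commGroupAddCommGroupEquivalence.{u}.functor.IsEquivalence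
  exact Presheaf.isSheaf_comp_of_isSheaf _ Scheme.Γ.{u}
    (forget₂ CommRingCat CommMonCat ⋙ CommMonCat.units ⋙ CommGrpCat.toAddCommGrp) isSheaf_Γ

theorem isContinuous_forget (P : MorphismProperty Scheme.{u}) [P.IsMultiplicative]
    [P.IsStableUnderBaseChange] [P.HasOfPostcompProperty P] (X : Scheme.{u}) :
    (MorphismProperty.Over.forget P ⊤ X).IsContinuous
      (Scheme.smallGrothendieckTopology X (P := P)) ((Scheme.grothendieckTopology P).over X) := by
  have : RepresentablyFlat (MorphismProperty.Over.forget P ⊤ X) :=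
    flat_of_preservesFiniteLimits _
  rw [Functor.isContinuous_iff_coverPreserving]
  exact Functor.coverPreserving_restrictedTopology _ _

instance isContinuous_etaleToScheme (X : Scheme.{u}) :
    (Scheme.Etale.forget X ⋙ Over.forget X).IsContinuous
      X.smallEtaleTopology Scheme.etaleTopology :=
  have : (Scheme.Etale.forget X).IsContinuous X.smallEtaleTopology
    (Scheme.etaleTopology.over X) := isContinuous_forget (@Etale) X
  Functor.isContinuous_comp _ _ _ (Scheme.etaleTopology.over X) _

/-- The étale sheaf of units `𝔾_m` on the small étale site of `X`. -/
noncomputable def Gm (X : Scheme.{u}) : Sheaf X.smallEtaleTopology Ab.{u} :=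
  ((Scheme.Etale.forget X ⋙ Over.forget X).sheafPushforwardContinuous Ab.{u}
    X.smallEtaleTopology Scheme.etaleTopology).obj ⟨unitsPresheaf, isSheaf_unitsPresheaf⟩

/-- `H⁰(X_ét, 𝔾_m)`: the sections of `𝔾_m` over the final object `X` of the étale site. -/
noncomputable abbrev H0Gm (X : Scheme.{u}) : Ab.{u} :=
  (Gm X).obj.obj (op (Scheme.Etale.mk (𝟙 X)))

/-- For a scheme `X` over a field `k`, the map `kˣ → H⁰(X_ét, 𝔾_m)`. -/
noncomputable def constUnits {X : Scheme.{u}} {k : Type u} [Field k]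
    (f : X ⟶ Spec (CommRingCat.of k)) : Additive kˣ →+ H0Gm X :=
  (MonoidHom.toAdditive (Units.map
    (((Scheme.ΓSpecIso (CommRingCat.of k)).inv ≫ f.appTop).hom : k →* Γ(X, ⊤))) :
      Additive kˣ →+ Additive Γ(X, ⊤)ˣ)

/-- `H⁰(X_ét, 𝔾_m) / k^*`, for a scheme `X` over a field `k`. -/
abbrev H0GmModConst {X : Scheme.{u}} {k : Type u} [Field k]
    (f : X ⟶ Spec (CommRingCat.of k)) : Type u :=
  H0Gm X ⧸ (constUnits f).range

end EtaleUnits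

section ClassGroup

variable (X : Scheme.{u})

/-- Weil divisors: finite formal sums of prime divisors, a prime divisor being given by its generic
point, that is, a point of codimension one. -/
abbrev WeilDivisor : Type u := {x : X // Order.coheight x = 1} →₀ ℤ

variable [IsIntegral X] [IsLocallyNoetherian X]

/-- The group of principal divisors `div f`, `f ∈ K(X)^*`. -/
noncomputable def principalDivisors : AddSubgroup (WeilDivisor X) where
  carrier := {D | ∃ f : X.functionField, f ≠ 0 ∧ ∀ x, D x = Scheme.ord f x.1}
  zero_mem' := ⟨1, one_ne_zero, fun x => by
    have := Scheme.ord_mul (X := X) (x := x.1) (one_ne_zero (α := X.functionField)) one_ne_zero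
    rw [mul_one] at this
    rw [Finsupp.zero_apply]; omega⟩
  add_mem' := by
    rintro D E ⟨f, hf, hD⟩ ⟨g, hg, hE⟩
    exact ⟨f * g, mul_ne_zero hf hg, fun x => by
      rw [Finsupp.add_apply, hD, hE, Scheme.ord_mul hf hg]⟩
  neg_mem' := by
    rintro D ⟨f, hf, hD⟩
    refine ⟨f⁻¹, inv_ne_zero hf, fun x => ?_⟩
    have := Scheme.ord_mul (X := X) (x := x.1) hf (inv_ne_zero hf)
    have h1 := Scheme.ord_mul (X := X) (x := x.1) (one_ne_zero (α := X.functionField)) one_ne_zero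
    rw [mul_inv_cancel₀ hf] at this
    rw [mul_one] at h1
    rw [Finsupp.neg_apply, hD]; omega

/-- The class group `Cl(X)` of Weil divisors modulo principal divisors. -/
abbrev ClassGroup : Type u := WeilDivisor X ⧸ principalDivisors X

end ClassGroup

end ToricFan


namespace ToricFan

/-- The pairing `M × (N ⊗ ℝ) → ℝ`, where `M = Hom(N, ℤ)` is identified with `ℤ ^ r` through the
dual basis. -/
def pairing {r : ℕ} (m : Fin r → ℤ) (x : Fin r → ℝ) : ℝ :=
  ∑ i, (m i : ℝ) * x i

/-- A rational polyhedral cone: generated by finitely many points of the lattice `N = ℤ ^ r`. -/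
def IsRational {r : ℕ} (σ : PointedCone ℝ (Fin r → ℝ)) : Prop :=
  ∃ V : Finset (Fin r → ℤ), σ = PointedCone.hull ℝ ((fun v i => (v i : ℝ)) '' (V : Set (Fin r → ℤ)))

/-- `τ` is a face of the (rational polyhedral) cone `σ`: there is `m ∈ σ^∨ ∩ M` with
`τ = σ ∩ m^⊥`. For a rational polyhedral cone `σ`, one gets the same faces if `m` runs through
the real dual cone `σ^∨`. -/
def IsFace {r : ℕ} (τ σ : PointedCone ℝ (Fin r → ℝ)) : Prop :=
  ∃ m : Fin r → ℤ, (∀ x ∈ σ, 0 ≤ pairing m x) ∧ ∀ x, x ∈ τ ↔ x ∈ σ ∧ pairing m x = 0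

/-- The dimension of a cone: the dimension of its linear span. -/
noncomputable def coneDim {r : ℕ} (σ : PointedCone ℝ (Fin r → ℝ)) : ℕ :=
  Module.finrank ℝ (Submodule.span ℝ (σ : Set (Fin r → ℝ)))

end ToricFan

/-- A finite rational fan on `N ⊗ ℝ`, `N = ℤ ^ r`: a finite nonempty set of strongly convex
rational polyhedral cones, closed under taking faces, in which any two cones meet in a common
face. -/
structure ToricFan (r : ℕ) where
  cones : Set (PointedCone ℝ (Fin r → ℝ))
  finite : cones.Finite
  nonempty : cones.Nonempty
  rational : ∀ σ ∈ cones, ToricFan.IsRational σ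
  stronglyConvex : ∀ σ ∈ cones, ∀ x ∈ σ, -x ∈ σ → x = 0
  face_mem : ∀ σ ∈ cones, ∀ τ, ToricFan.IsFace τ σ → τ ∈ cones
  inter_isFace : ∀ σ ∈ cones, ∀ τ ∈ cones,
    ToricFan.IsFace (σ ⊓ τ) σ ∧ ToricFan.IsFace (σ ⊓ τ) τ

namespace ToricFan

section Cones

variable {r : ℕ}

theorem pairing_add_left (m m' : Fin r → ℤ) (x : Fin r → ℝ) :
    pairing (m + m') x = pairing m x + pairing m' x := by
  simp [pairing, add_mul, Finset.sum_add_distrib]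

theorem pairing_nsmul_left (n : ℕ) (m : Fin r → ℤ) (x : Fin r → ℝ) :
    pairing (n • m) x = n * pairing m x := by
  simp [pairing, Finset.mul_sum, mul_assoc]

theorem pairing_neg_left (m : Fin r → ℤ) (x : Fin r → ℝ) :
    pairing (-m) x = - pairing m x := by
  simp [pairing]

theorem pairing_add_right (m : Fin r → ℤ) (x y : Fin r → ℝ) :
    pairing m (x + y) = pairing m x + pairing m y := by
  simp [pairing, mul_add, Finset.sum_add_distrib]

theorem pairing_smul_right (m : Fin r → ℤ) (c : ℝ) (x : Fin r → ℝ) :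
    pairing m (c • x) = c * pairing m x := by
  simp [pairing, Finset.mul_sum, mul_left_comm]

theorem pairing_intCast (m v : Fin r → ℤ) :
    pairing m (fun i => (v i : ℝ)) = ((∑ i, m i * v i : ℤ) : ℝ) := by
  simp [pairing]

/-- The semigroup `σ^∨ ∩ M` of lattice points of the dual cone. -/
def dualMonoid (σ : PointedCone ℝ (Fin r → ℝ)) : AddSubmonoid (Fin r → ℤ) where
  carrier := {m | ∀ x ∈ σ, 0 ≤ pairing m x}
  zero_mem' := fun x _ => by simp [pairing]
  add_mem' := fun {a b} ha hb x hx => by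
    rw [pairing_add_left]; exact add_nonneg (ha x hx) (hb x hx)

theorem mem_dualMonoid {σ : PointedCone ℝ (Fin r → ℝ)} {m : Fin r → ℤ} :
    m ∈ dualMonoid σ ↔ ∀ x ∈ σ, 0 ≤ pairing m x := Iff.rfl

theorem dualMonoid_anti {σ τ : PointedCone ℝ (Fin r → ℝ)} (h : τ ≤ σ) :
    dualMonoid σ ≤ dualMonoid τ := fun _ hm x hx => hm x (h hx)

theorem IsFace.le {τ σ : PointedCone ℝ (Fin r → ℝ)} (h : IsFace τ σ) : τ ≤ σ := by
  obtain ⟨m, _, h⟩ := h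
  exact fun x hx => ((h x).1 hx).1

theorem mem_dualMonoid_hull {V : Set (Fin r → ℤ)} {m : Fin r → ℤ} :
    m ∈ dualMonoid (PointedCone.hull ℝ ((fun v i => (v i : ℝ)) '' V)) ↔
      ∀ v ∈ V, 0 ≤ ∑ i, m i * v i := by
  constructor
  · intro h v hv
    have := h _ (PointedCone.subset_hull ⟨v, hv, rfl⟩)
    rw [pairing_intCast] at this
    exact_mod_cast this
  · intro h x hx
    induction hx using Submodule.span_induction with
    | mem x hx =>
      obtain ⟨v, hv, rfl⟩ := hx
      rw [pairing_intCast]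
      exact_mod_cast h v hv
    | zero => simp [pairing]
    | add x y _ _ hx hy => rw [pairing_add_right]; exact add_nonneg hx hy
    | smul a x _ hx =>
      change 0 ≤ pairing m ((a : ℝ) • x)
      rw [pairing_smul_right]; exact mul_nonneg a.2 hx

/-- If `τ = σ ∩ m^⊥` is a face of `σ`, every element of `τ^∨ ∩ M` is of the form `u - n m` with
`u ∈ σ^∨ ∩ M`. -/
theorem exists_add_nsmul_mem {τ σ : PointedCone ℝ (Fin r → ℝ)} (hσ : IsRational σ)
    {m : Fin r → ℤ} (hm : m ∈ dualMonoid σ) (h : ∀ x, x ∈ τ ↔ x ∈ σ ∧ pairing m x = 0)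
    {u : Fin r → ℤ} (hu : u ∈ dualMonoid τ) :
    ∃ n : ℕ, ∀ n' ≥ n, u + n' • m ∈ dualMonoid σ := by
  obtain ⟨V, rfl⟩ := hσ
  refine ⟨∑ v ∈ V, (∑ i, u i * v i).natAbs, fun n' hn' => ?_⟩
  rw [mem_dualMonoid_hull] at hm ⊢
  intro v hv
  have e : ∑ i, (u + n' • m) i * v i = ∑ i, u i * v i + n' * ∑ i, m i * v i := by
    simp [add_mul, Finset.sum_add_distrib, Finset.mul_sum, mul_assoc]
  rw [e]
  have hmv := hm v hv
  have hvσ : (fun i => (v i : ℝ)) ∈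
      PointedCone.hull ℝ ((fun (v : Fin r → ℤ) i => (v i : ℝ)) '' (V : Set (Fin r → ℤ))) :=
    PointedCone.subset_hull ⟨v, hv, rfl⟩
  rcases hmv.eq_or_lt with h0 | h0
  · have := hu _ ((h _).2 ⟨hvσ, by rw [pairing_intCast, ← h0]; simp⟩)
    rw [pairing_intCast] at this
    have : 0 ≤ ∑ i, u i * v i := by exact_mod_cast this
    rw [← h0]; simpa using this
  · have h1 : (∑ i, u i * v i).natAbs ≤ ∑ v ∈ V, (∑ i, u i * v i).natAbs :=
      Finset.single_le_sum (f := fun v => (∑ i, u i * v i).natAbs) (fun _ _ => Nat.zero_le _) hv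
    have h2 : ((∑ i, u i * v i).natAbs : ℤ) ≤ n' := by exact_mod_cast h1.trans hn'
    have h3 : -((∑ i, u i * v i).natAbs : ℤ) ≤ ∑ i, u i * v i := by omega
    nlinarith

/-- Gordan's lemma: `σ^∨ ∩ M` is finitely generated. -/
theorem fg_dualMonoid {σ : PointedCone ℝ (Fin r → ℝ)} (hσ : IsRational σ) :
    (dualMonoid σ).FG := by
  obtain ⟨V, rfl⟩ := hσ
  let f : ((Fin r → ℕ) × (Fin r → ℕ)) × (V → ℕ) →+ (V → ℤ) :=
    { toFun := fun p v => ∑ i, ((p.1.1 i : ℤ) - p.1.2 i) * v.1 i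
      map_zero' := by ext; simp
      map_add' := fun p q => by
        ext v
        simp only [Pi.add_apply, Prod.fst_add, Prod.snd_add, ← Finset.sum_add_distrib]
        exact Finset.sum_congr rfl fun i _ => by push_cast; ring }
  let g : ((Fin r → ℕ) × (Fin r → ℕ)) × (V → ℕ) →+ (V → ℤ) :=
    { toFun := fun p v => p.2 v
      map_zero' := by ext; simp
      map_add' := fun p q => by ext v; simp }
  let d : ((Fin r → ℕ) × (Fin r → ℕ)) × (V → ℕ) →+ (Fin r → ℤ) :=
    { toFun := fun p i => (p.1.1 i : ℤ) - p.1.2 i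
      map_zero' := by ext; simp
      map_add' := fun p q => by ext i; simp; ring }
  have hfg : (f.eqLocusM g).FG := AddSubmonoid.fg_eqLocusM f g
  have : dualMonoid (PointedCone.hull ℝ ((fun v i => (v i : ℝ)) '' (V : Set (Fin r → ℤ)))) =
      (f.eqLocusM g).map d := by
    ext m
    rw [mem_dualMonoid_hull, AddSubmonoid.mem_map]
    constructor
    · intro h
      refine ⟨((fun i => (m i).toNat, fun i => (-m i).toNat),
        fun v => (∑ i, m i * v.1 i).toNat), ?_, ?_⟩
      · change f _ = g _
        ext v
        have e : ∀ i, (((m i).toNat : ℤ) - ((-m i).toNat : ℤ)) = m i := fun i => by omega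
        change ∑ i, (((m i).toNat : ℤ) - ((-m i).toNat : ℤ)) * v.1 i =
          ((∑ i, m i * v.1 i).toNat : ℤ)
        simp only [e]
        rw [Int.toNat_of_nonneg (h v.1 v.2)]
      · ext i
        change ((m i).toNat : ℤ) - ((-m i).toNat : ℤ) = m i
        omega
    · rintro ⟨p, hp, rfl⟩ v hv
      have : f p = g p := hp
      have := congrFun this ⟨v, hv⟩
      change ∑ i, ((p.1.1 i : ℤ) - p.1.2 i) * v i = (p.2 ⟨v, hv⟩ : ℤ) at this
      change 0 ≤ ∑ i, ((p.1.1 i : ℤ) - p.1.2 i) * v i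
      rw [this]; positivity
  rw [this]
  exact hfg.map d

end Cones

section Charts

variable {r : ℕ} (k : Type u) [Field k]

instance instTwoUniqueSums (S : AddSubmonoid (Fin r → ℤ)) : TwoUniqueSums S :=
  TwoUniqueSums.of_injective_addHom S.subtype.toAddHom Subtype.val_injective inferInstance

/-- The coordinate ring `k[σ^∨ ∩ M]` of the affine toric variety `U_σ`. -/
abbrev coordRing (σ : PointedCone ℝ (Fin r → ℝ)) : Type u :=
  AddMonoidAlgebra k (dualMonoid σ)

instance (σ : PointedCone ℝ (Fin r → ℝ)) : IsDomain (coordRing k σ) :=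
  NoZeroDivisors.to_isDomain _

/-- The inclusion `k[σ^∨ ∩ M] ⊆ k[τ^∨ ∩ M]` for `τ ⊆ σ`. -/
noncomputable def coordMap {σ τ : PointedCone ℝ (Fin r → ℝ)} (h : τ ≤ σ) :
    coordRing k σ →+* coordRing k τ :=
  AddMonoidAlgebra.mapDomainRingHom k (AddSubmonoid.inclusion (dualMonoid_anti h))

@[simp]
theorem coordMap_single {σ τ : PointedCone ℝ (Fin r → ℝ)} (h : τ ≤ σ) (m : dualMonoid σ) (a : k) :
    coordMap k h (AddMonoidAlgebra.single m a) =
      AddMonoidAlgebra.single (AddSubmonoid.inclusion (dualMonoid_anti h) m) a := by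
  simp [coordMap]

theorem coordMap_injective {σ τ : PointedCone ℝ (Fin r → ℝ)} (h : τ ≤ σ) :
    Function.Injective (coordMap k h) :=
  AddMonoidAlgebra.mapDomain_injective (AddSubmonoid.inclusion_injective _)

theorem coordMap_id (σ : PointedCone ℝ (Fin r → ℝ)) :
    coordMap k (le_refl σ) = RingHom.id _ :=
  AddMonoidAlgebra.mapDomainRingHom_id

theorem coordMap_comp {ρ σ τ : PointedCone ℝ (Fin r → ℝ)} (h : τ ≤ σ) (h' : ρ ≤ τ) :
    (coordMap k h').comp (coordMap k h) = coordMap k (h'.trans h) :=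
  (AddMonoidAlgebra.mapDomainRingHom_comp _ _).symm

theorem coordMap_comp_algebraMap {σ τ : PointedCone ℝ (Fin r → ℝ)} (h : τ ≤ σ) :
    (coordMap k h).comp (algebraMap k (coordRing k σ)) = algebraMap k (coordRing k τ) := by
  ext; simp

/-- For a face `τ = σ ∩ m^⊥`, the ring `k[τ^∨ ∩ M]` is the localization of `k[σ^∨ ∩ M]` at the
character of `m`. -/
theorem isLocalization_coordMap {σ τ : PointedCone ℝ (Fin r → ℝ)} (hσ : IsRational σ)
    (hle : τ ≤ σ) (m : dualMonoid σ)
    (h : ∀ x, x ∈ τ ↔ x ∈ σ ∧ pairing (m : Fin r → ℤ) x = 0) :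
    let := (coordMap k hle).toAlgebra
    IsLocalization.Away (AddMonoidAlgebra.single m (1 : k) : coordRing k σ) (coordRing k τ) := by
  let := (coordMap k hle).toAlgebra
  have hneg : -(m : Fin r → ℤ) ∈ dualMonoid τ := fun x hx => by
    rw [pairing_neg_left, ((h x).1 hx).2, neg_zero]
  have hpow : ∀ n : ℕ, (AddMonoidAlgebra.single m (1 : k) : coordRing k σ) ^ n =
      AddMonoidAlgebra.single (n • m) 1 := fun n => by
    rw [AddMonoidAlgebra.single_pow, one_pow]
  have key : ∀ z : coordRing k τ, ∃ n : ℕ, ∀ n' ≥ n, ∃ w : coordRing k σ,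
      z * coordMap k hle (AddMonoidAlgebra.single m (1 : k) ^ n') = coordMap k hle w := by
    intro z
    induction z using AddMonoidAlgebra.induction_linear with
    | zero => exact ⟨0, fun n' _ => ⟨0, by simp⟩⟩
    | add f g hf hg =>
      obtain ⟨a, ha⟩ := hf
      obtain ⟨b, hb⟩ := hg
      refine ⟨max a b, fun n' hn' => ?_⟩
      obtain ⟨w, hw⟩ := ha n' ((le_max_left _ _).trans hn')
      obtain ⟨w', hw'⟩ := hb n' ((le_max_right _ _).trans hn')
      exact ⟨w + w', by rw [add_mul, hw, hw', map_add]⟩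
    | single u c =>
      obtain ⟨n, hn⟩ := exists_add_nsmul_mem hσ m.2 h u.2
      refine ⟨n, fun n' hn' => ⟨AddMonoidAlgebra.single ⟨_, hn n' hn'⟩ c, ?_⟩⟩
      rw [hpow, coordMap_single, coordMap_single, AddMonoidAlgebra.single_mul_single, mul_one]
      rfl
  refine ⟨?_, fun z => ?_, fun {x y} hxy => ⟨1, ?_⟩⟩
  · rintro ⟨_, n, rfl⟩
    refine IsUnit.of_mul_eq_one (AddMonoidAlgebra.single ⟨n • -(m : Fin r → ℤ),
      (dualMonoid τ).nsmul_mem hneg n⟩ 1) ?_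
    change coordMap k hle (AddMonoidAlgebra.single m (1 : k) ^ n) * _ = 1
    rw [hpow, coordMap_single, AddMonoidAlgebra.single_mul_single, one_mul,
      AddMonoidAlgebra.one_def]
    congr 1
    ext i
    simp
  · obtain ⟨n, hn⟩ := key z
    obtain ⟨w, hw⟩ := hn n le_rfl
    exact ⟨⟨w, _, n, rfl⟩, hw⟩
  · rw [coordMap_injective k hle hxy]

/-- The affine toric variety `U_σ = Spec k[σ^∨ ∩ M]`. -/
noncomputable abbrev chart (σ : PointedCone ℝ (Fin r → ℝ)) : Scheme.{u} :=
  Spec (CommRingCat.of (coordRing k σ))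

/-- The morphism `U_τ ⟶ U_σ` for `τ ⊆ σ`. -/
noncomputable abbrev chartMap {σ τ : PointedCone ℝ (Fin r → ℝ)} (h : τ ≤ σ) :
    chart k τ ⟶ chart k σ :=
  Spec.map (CommRingCat.ofHom (coordMap k h))

theorem isOpenImmersion_chartMap {σ τ : PointedCone ℝ (Fin r → ℝ)} (hσ : IsRational σ)
    (hf : IsFace τ σ) (hle : τ ≤ σ) : IsOpenImmersion (chartMap k hle) := by
  obtain ⟨m, hm, h⟩ := hf
  let := (coordMap k hle).toAlgebra
  have := isLocalization_coordMap k hσ hle ⟨m, hm⟩ h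
  exact IsOpenImmersion.of_isLocalization
    (AddMonoidAlgebra.single (⟨m, hm⟩ : dualMonoid σ) (1 : k) : coordRing k σ)

theorem range_chartMap {σ τ : PointedCone ℝ (Fin r → ℝ)} (hσ : IsRational σ)
    (hle : τ ≤ σ) (m : dualMonoid σ)
    (h : ∀ x, x ∈ τ ↔ x ∈ σ ∧ pairing (m : Fin r → ℤ) x = 0) :
    Set.range (chartMap k hle) = (PrimeSpectrum.basicOpen
      (AddMonoidAlgebra.single m (1 : k) : coordRing k σ) : Set (PrimeSpectrum _)) := by
  let := (coordMap k hle).toAlgebra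
  have := isLocalization_coordMap k hσ hle m h
  exact PrimeSpectrum.localization_away_comap_range (coordRing k τ)
    (AddMonoidAlgebra.single m (1 : k) : coordRing k σ)

/-- `U_τ ∩ U_τ' = U_{τ ∩ τ'}` inside `U_σ`, for faces `τ`, `τ'` of `σ`. -/
theorem range_chartMap_inf {σ τ τ' : PointedCone ℝ (Fin r → ℝ)} (hσ : IsRational σ)
    (hf : IsFace τ σ) (hf' : IsFace τ' σ) :
    Set.range (chartMap k (inf_le_left.trans hf.le : τ ⊓ τ' ≤ σ)) =
      Set.range (chartMap k hf.le) ∩ Set.range (chartMap k hf'.le) := by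
  obtain ⟨m, hm, h⟩ := hf
  obtain ⟨m', hm', h'⟩ := hf'
  rw [range_chartMap k hσ _ ⟨m, hm⟩ h, range_chartMap k hσ _ ⟨m', hm'⟩ h',
    range_chartMap k hσ _ (⟨m, hm⟩ + ⟨m', hm'⟩)]
  · have e : (AddMonoidAlgebra.single ((⟨m, hm⟩ : dualMonoid σ) + ⟨m', hm'⟩) (1 : k) :
        coordRing k σ) = AddMonoidAlgebra.single ⟨m, hm⟩ 1 * AddMonoidAlgebra.single ⟨m', hm'⟩ 1 := by
      rw [AddMonoidAlgebra.single_mul_single, one_mul]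
    rw [e, PrimeSpectrum.basicOpen_mul]
    rfl
  intro x
  rw [Submodule.mem_inf, h, h']
  change _ ↔ x ∈ σ ∧ pairing (m + m') x = 0
  rw [pairing_add_left]
  constructor
  · rintro ⟨⟨hx, h1⟩, _, h2⟩
    exact ⟨hx, by rw [h1, h2, add_zero]⟩
  · rintro ⟨hx, hs⟩
    have h1 := hm x hx
    have h2 := hm' x hx
    exact ⟨⟨hx, by linarith⟩, hx, by linarith⟩

end Charts

/-! ### The toric variety of a fan -/

section Variety

variable {r : ℕ} (Δ : ToricFan r) (k : Type u) [Field k]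

/-- The type of cones of the fan `Δ`. -/
def Cone : Type := {σ : PointedCone ℝ (Fin r → ℝ) // σ ∈ Δ.cones}

/-- Cones of a fan are ordered by inclusion (which is the same as the face relation). -/
instance : PartialOrder Δ.Cone := inferInstanceAs (PartialOrder {σ // σ ∈ Δ.cones})

variable {Δ} in
theorem isFace_of_le {τ σ : Δ.Cone} (h : τ ≤ σ) : IsFace τ.1 σ.1 := by
  have := (Δ.inter_isFace τ.1 τ.2 σ.1 σ.2).2
  rwa [inf_eq_left.2 (show τ.1 ≤ σ.1 from h)] at this

/-- The intersection of two cones of a fan. -/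
def interCone (σ τ : Δ.Cone) : Δ.Cone :=
  ⟨σ.1 ⊓ τ.1, Δ.face_mem σ.1 σ.2 _ (Δ.inter_isFace σ.1 σ.2 τ.1 τ.2).1⟩

/-- The diagram of affine charts `σ ↦ U_σ`, with the transition maps `U_τ ⟶ U_σ` for `τ ⊆ σ`. -/
noncomputable def diagram : Δ.Cone ⥤ Scheme.{u} where
  obj σ := chart k σ.1
  map {τ σ} f := chartMap k (show τ.1 ≤ σ.1 from leOfHom f)
  map_id σ := by
    simp only [chartMap, coordMap_id]; exact Spec.map_id _
  map_comp {ρ τ σ} f g := by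
    rw [← Spec.map_comp, ← CommRingCat.ofHom_comp, coordMap_comp]

instance {τ σ : Δ.Cone} (f : τ ⟶ σ) : IsOpenImmersion ((Δ.diagram k).map f) :=
  isOpenImmersion_chartMap k (Δ.rational σ.1 σ.2) (isFace_of_le (leOfHom f)) _

instance : (Δ.diagram k ⋙ Scheme.forget).IsLocallyDirected where
  cond {τ τ' σ} f g x y hxy := by
    have hf := isFace_of_le (leOfHom f)
    have hg := isFace_of_le (leOfHom g)
    have hxy' : (Δ.diagram k).map f x = (Δ.diagram k).map g y := hxy
    have hmem : (Δ.diagram k).map f x ∈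
        Set.range (chartMap k (inf_le_left.trans hf.le : τ.1 ⊓ τ'.1 ≤ σ.1)) := by
      rw [range_chartMap_inf k (Δ.rational σ.1 σ.2) hf hg]
      exact ⟨⟨x, rfl⟩, ⟨y, hxy'.symm⟩⟩
    let a : Δ.interCone τ τ' ⟶ τ := homOfLE (show τ.1 ⊓ τ'.1 ≤ τ.1 from inf_le_left)
    let b : Δ.interCone τ τ' ⟶ τ' := homOfLE (show τ.1 ⊓ τ'.1 ≤ τ'.1 from inf_le_right)
    obtain ⟨(z : (Δ.diagram k).obj (Δ.interCone τ τ')), hz⟩ := hmem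
    have h1 : (Δ.diagram k).map f ((Δ.diagram k).map a z) = (Δ.diagram k).map f x := by
      rw [← Scheme.Hom.comp_apply, ← Functor.map_comp]; exact hz
    have h2 : (Δ.diagram k).map g ((Δ.diagram k).map b z) = (Δ.diagram k).map g y := by
      rw [← Scheme.Hom.comp_apply, ← Functor.map_comp]; exact hz.trans hxy'
    exact ⟨Δ.interCone τ τ', a, b, z, ((Δ.diagram k).map f).isOpenEmbedding.injective h1,
      ((Δ.diagram k).map g).isOpenEmbedding.injective h2⟩

/-- The toric variety `T_N emb(Δ, k)`: the charts `U_σ = Spec k[σ^∨ ∩ M]`, `σ ∈ Δ`, glued along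
the open immersions `U_τ ⟶ U_σ` for the faces `τ` of `σ`. -/
noncomputable def variety : Scheme.{u} := colimit (Δ.diagram k)

/-- The structure morphism of the toric variety. -/
noncomputable def structureMap : Δ.variety k ⟶ Spec (CommRingCat.of k) :=
  colimit.desc (Δ.diagram k)
    { pt := Spec (CommRingCat.of k)
      ι :=
        { app := fun σ => Spec.map (CommRingCat.ofHom (algebraMap k (coordRing k σ.1)))
          naturality := fun τ σ f => by
            change Spec.map _ ≫ Spec.map _ = Spec.map _ ≫ 𝟙 _
            rw [Category.comp_id, ← Spec.map_comp, ← CommRingCat.ofHom_comp,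
              coordMap_comp_algebraMap] } }

/-- The affine open cover of the toric variety by the charts `U_σ`. -/
noncomputable def cover : (Δ.variety k).OpenCover :=
  Scheme.IsLocallyDirected.openCover (Δ.diagram k)

instance isLocallyNoetherian_variety : IsLocallyNoetherian (Δ.variety k) := by
  refine (isLocallyNoetherian_iff_openCover (Δ.cover k)).2 fun σ => ?_
  change IsLocallyNoetherian (chart k (Subtype.val (p := (· ∈ Δ.cones)) σ))
  have hσ := fg_dualMonoid (Δ.rational _ (Subtype.prop (p := (· ∈ Δ.cones)) σ))
  have := (AddMonoid.fg_iff_addSubmonoid_fg _).2 hσ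
  have : IsNoetherianRing (coordRing k (Subtype.val (p := (· ∈ Δ.cones)) σ)) :=
    Algebra.FiniteType.isNoetherianRing k _
  infer_instance

instance isIntegral_variety : IsIntegral (Δ.variety k) := by
  have hcov : ∀ x : Δ.variety k, ∃ σ, x ∈ Set.range (colimit.ι (Δ.diagram k) σ) := fun x => by
    obtain ⟨σ, y, hy⟩ := Scheme.IsLocallyDirected.ι_jointly_surjective (Δ.diagram k) x
    exact ⟨σ, y, hy⟩
  have hint : ∀ σ, IsIntegral ((Δ.diagram k).obj σ) := fun σ =>
    inferInstanceAs (IsIntegral (Spec (CommRingCat.of (coordRing k σ.1))))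
  have hred : IsReduced (Δ.variety k) := by
    have : ∀ σ, IsReduced ((Δ.cover k).X σ) := fun σ =>
      inferInstanceAs (IsReduced (Spec (CommRingCat.of (coordRing k
        (Subtype.val (p := (· ∈ Δ.cones)) σ)))))
    exact IsReduced.of_openCover _ (Δ.cover k)
  have hne : Nonempty (Δ.variety k) := by
    obtain ⟨σ, hσ⟩ := Δ.nonempty
    obtain ⟨x⟩ := (hint ⟨σ, hσ⟩).nonempty
    exact ⟨colimit.ι (Δ.diagram k) ⟨σ, hσ⟩ x⟩
  have hmeet : ∀ (τ σ : Δ.Cone), τ ≤ σ → ∀ V : Set (Δ.variety k), IsOpen V →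
      (∃ x, colimit.ι (Δ.diagram k) σ x ∈ V) → ∃ x, colimit.ι (Δ.diagram k) τ x ∈ V := by
    intro τ σ hle V hV hx
    have hV' := hV.preimage (colimit.ι (Δ.diagram k) σ).continuous
    have hr := ((Δ.diagram k).map (homOfLE hle)).isOpenEmbedding.isOpen_range
    obtain ⟨y0⟩ := (hint τ).nonempty
    obtain ⟨_, hy, ⟨z, rfl⟩⟩ := nonempty_preirreducible_inter hV' hr hx ⟨_, y0, rfl⟩
    refine ⟨z, ?_⟩
    rw [← colimit.w (Δ.diagram k) (homOfLE hle)]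
    exact hy
  have hirr : IrreducibleSpace (Δ.variety k) :=
    { toNonempty := hne
      isPreirreducible_univ := by
        rintro V W hV hW ⟨x, -, hx⟩ ⟨y, -, hy⟩
        obtain ⟨σ, x, rfl⟩ := hcov x
        obtain ⟨τ, y, rfl⟩ := hcov y
        have h1 := hmeet (Δ.interCone σ τ) σ (show σ.1 ⊓ τ.1 ≤ σ.1 from inf_le_left) V hV ⟨x, hx⟩
        have h2 := hmeet (Δ.interCone σ τ) τ (show σ.1 ⊓ τ.1 ≤ τ.1 from inf_le_right) W hW ⟨y, hy⟩
        obtain ⟨z, hz, hz'⟩ := nonempty_preirreducible_inter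
          (hV.preimage (colimit.ι (Δ.diagram k) (Δ.interCone σ τ)).continuous)
          (hW.preimage (colimit.ι (Δ.diagram k) (Δ.interCone σ τ)).continuous) h1 h2
        exact ⟨_, trivial, hz, hz'⟩ }
  exact isIntegral_of_irreducibleSpace_of_isReduced _

end Variety

end ToricFan

/-! ### Invariants of fans -/

namespace ToricFan

variable {r : ℕ}

/-- The topology on the finite set of cones of `Δ` whose open sets are the subfans, i.e. the
subsets closed under taking faces. This space is `Δ_top`. -/
instance (Δ : ToricFan r) : TopologicalSpace Δ.Cone where
  IsOpen s := ∀ σ ∈ s, ∀ τ : Δ.Cone, IsFace τ.1 σ.1 → τ ∈ s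
  isOpen_univ := fun _ _ _ _ => trivial
  isOpen_inter := fun _ _ hs ht σ hσ τ hτ => ⟨hs σ hσ.1 τ hτ, ht σ hσ.2 τ hτ⟩
  isOpen_sUnion := fun _ hS σ ⟨s, hs, hσ⟩ τ hτ => ⟨s, hs, hS s hs σ hσ τ hτ⟩

/-- The support `|Δ|`. -/
def support (Δ : ToricFan r) : Set (Fin r → ℝ) :=
  ⋃ σ ∈ Δ.cones, (σ : Set (Fin r → ℝ))

/-- `Δ` is complete if `|Δ| = N ⊗ ℝ`. -/
def IsComplete (Δ : ToricFan r) : Prop := Δ.support = Set.univ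

/-- `s = dim ℝ|Δ|`, the dimension of the vector space spanned by the support. -/
noncomputable def spanDim (Δ : ToricFan r) : ℕ :=
  Module.finrank ℝ (Submodule.span ℝ Δ.support)

/-- `#Δ(1)`, the number of one-dimensional cones. -/
noncomputable def numRays (Δ : ToricFan r) : ℕ :=
  {σ ∈ Δ.cones | coneDim σ = 1}.ncard

/-- The vector space `(H⁰(X_ét, 𝔾_m) / k^*) ⊗ ℚ`, for the toric variety `X` of `Δ` over `k`. -/
abbrev unitsQ (Δ : ToricFan r) (k : Type u) [Field k] : Type u :=
  ℚ ⊗[ℤ] H0GmModConst (Δ.structureMap k)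

/-- The vector space `Cl(X) ⊗ ℚ`, for the toric variety `X` of `Δ` over `k`. -/
abbrev classGroupQ (Δ : ToricFan r) (k : Type u) [Field k] : Type u :=
  ℚ ⊗[ℤ] ClassGroup (Δ.variety k)

/-- `ρ₀ = dim_ℚ (H⁰(X_ét, 𝔾_m) / k^*) ⊗ ℚ`. -/
noncomputable def rho0 (Δ : ToricFan r) (k : Type u) [Field k] : ℕ :=
  Module.finrank ℚ (Δ.unitsQ k)

/-- `ρ₁' = dim_ℚ Cl(X) ⊗ ℚ`. -/
noncomputable def rho1' (Δ : ToricFan r) (k : Type u) [Field k] : ℕ :=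
  Module.finrank ℚ (Δ.classGroupQ k)

/-- The invariant `β` of fans on `N ⊗ ℝ` is a topological invariant of the given fan `Δ`: it takes
the same value on all fans `Δ'` on `N ⊗ ℝ` with `Δ'_top ≅ Δ_top`. -/
def IsTopologicalInvariantOf {α : Type*} (β : ToricFan r → α) (Δ : ToricFan r) : Prop :=
  ∀ Δ' : ToricFan r, Nonempty (Δ.Cone ≃ₜ Δ'.Cone) → β Δ' = β Δ

/-- `β` is a topological invariant: it takes the same value on any two fans on `N ⊗ ℝ` with
homeomorphic associated topological spaces. -/
def IsTopologicalInvariant {α : Type*} (β : ToricFan r → α) : Prop :=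
  ∀ Δ : ToricFan r, IsTopologicalInvariantOf β Δ

end ToricFan

/-!
Let `M = ℤ ^ r` be the character lattice and `X` the toric variety of a fan `Δ`. Everything follows
from the two formulas `ρ₀ = r - s` and `ρ₁' = #Δ(1) - s`, and from the fact that the space
`Δ_top` determines the poset of cones (specialization is inclusion), hence the dimension of each
cone, which is its height in this poset. So `#Δ(1)` depends only on `Δ_top`, and so does the
existence of a cone of dimension `r`, which forces `s = r`. On the other hand `s` itself is not
determined: the fans with rays through `e₀, e₁` and through `e₀, -e₀` have homeomorphic spaces.

Units. All charts `Spec k[σ^∨ ∩ M]` contain the torus `Spec k[M]`, the chart of the zero cone. As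
`M` has two unique sums, the units of `k[σ^∨ ∩ M]` are the monomials `c χ^m` with `m` orthogonal to
`σ`. Hence the global units of `X` modulo constants are the lattice `|Δ|^⊥ ∩ M`
(`nonempty_addEquiv_H0GmModConst`), whose rank is `r - s` since the row and column ranks of a matrix
agree (`finrank_orthogonalLattice_add_spanDim`).

Divisors. There is an exact sequence `M → ℤ^Δ(1) → Cl(X) → 0` in which the kernel of the first map
is again `|Δ|^⊥ ∩ M`, because strongly convex rational cones are spanned by their rays; counting
ranks gives the second formula. For its exactness:
* `k[M]` is a localization of a polynomial ring, hence factorial. So every divisor is linearly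
  equivalent to one supported outside of the torus (`exists_ord_eq_on_chart`), and a rational
  function without zeros and poles on the torus is a unit of `k[M]`, that is, a monomial
  (`exists_unit_of_ord_eq_zero_on_chart`).
* The prime divisors outside of the torus correspond to the rays (`exists_rayPoint_eq`). If `σ` is
  the smallest cone whose chart contains the generic point `x` of such a divisor, then all
  characters outside of `σ^⊥` vanish at `x`; if `dim σ ≥ 2`, a face strictly between `0` and `σ`
  gives a nonzero prime ideal strictly below that of `x`.
* A character has order zero along the divisor of a ray if and only if it is orthogonal to the ray
  (`ord_character_eq_zero_iff`).

The convex geometry needed (separation of lattice points from rational cones, existence of faces)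
is derived from Farkas' lemma over `ℚ`.
-/

/-! ### Farkas' lemma -/

/-- **Farkas' lemma** over an ordered field, for a finite family of linear functionals. The
induction on the family does not use any topology. -/
theorem exists_nonneg_combination_of_forall_nonneg {K W ι : Type*} [Field K] [LinearOrder K]
    [IsStrictOrderedRing K] [AddCommGroup W] [Module K W] [DecidableEq ι] (s : Finset ι) :
    ∀ (a : ι → Module.Dual K W) (b : Module.Dual K W),
      (∀ x, (∀ i ∈ s, 0 ≤ a i x) → 0 ≤ b x) →
      ∃ c : ι → K, (∀ i ∈ s, 0 ≤ c i) ∧ b = ∑ i ∈ s, c i • a i := by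
  induction s using Finset.induction_on with
  | empty =>
    intro a b h
    refine ⟨0, by simp, ?_⟩
    ext x
    have h1 := h x (by simp)
    have h2 := h (-x) (by simp)
    rw [map_neg] at h2
    simp only [Finset.sum_empty, LinearMap.zero_apply]
    linarith
  | insert j s hj ih =>
    intro a b h
    by_cases h0 : ∀ x, (∀ i ∈ s, 0 ≤ a i x) → 0 ≤ b x
    · obtain ⟨c, hc, hb⟩ := ih a b h0
      refine ⟨Function.update c j 0, fun i hi => ?_, ?_⟩
      · rcases eq_or_ne i j with rfl | hij
        · simp
        · rw [Function.update_of_ne hij]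
          exact hc i (Finset.mem_of_mem_insert_of_ne hi hij)
      · rw [Finset.sum_insert hj, Function.update_self, zero_smul, zero_add, hb]
        refine Finset.sum_congr rfl fun i hi => ?_
        rw [Function.update_of_ne (ne_of_mem_of_not_mem hi hj)]
    · push Not at h0
      obtain ⟨x₀, hx₀, hbx₀⟩ := h0
      have hjx₀ : a j x₀ < 0 := by
        by_contra hcon
        exact absurd (h x₀ fun i hi => by
          rcases Finset.mem_insert.1 hi with rfl | hi
          · exact not_lt.1 hcon
          · exact hx₀ i hi) (not_le.2 hbx₀)
      have hne := hjx₀.ne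
      -- replace each functional by its composite with the projection onto `ker (a j)` along `x₀`
      obtain ⟨c, hc, hb⟩ := ih (fun i => a i - (a i x₀ / a j x₀) • a j)
        (b - (b x₀ / a j x₀) • a j) (fun x hx => by
          have := h (x - (a j x / a j x₀) • x₀) (fun i hi => by
            rcases Finset.mem_insert.1 hi with rfl | hi
            · rw [map_sub, map_smul, smul_eq_mul, div_mul_cancel₀ _ hne, sub_self]
            · have := hx i hi
              simp only [LinearMap.sub_apply, LinearMap.smul_apply, smul_eq_mul] at this
              rw [map_sub, map_smul, smul_eq_mul]
              convert this using 1
              field_simp)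
          simp only [LinearMap.sub_apply, LinearMap.smul_apply, smul_eq_mul]
          rw [map_sub, map_smul, smul_eq_mul] at this
          convert this using 1
          field_simp)
      refine ⟨Function.update c j ((b x₀ - ∑ i ∈ s, c i * a i x₀) / a j x₀), fun i hi => ?_, ?_⟩
      · rcases eq_or_ne i j with rfl | hij
        · rw [Function.update_self]
          refine div_nonneg_of_nonpos ?_ hjx₀.le
          have : 0 ≤ ∑ i ∈ s, c i * a i x₀ :=
            Finset.sum_nonneg fun i hi => mul_nonneg (hc i hi) (hx₀ i hi)
          linarith
        · rw [Function.update_of_ne hij]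
          exact hc i (Finset.mem_of_mem_insert_of_ne hi hij)
      · rw [Finset.sum_insert hj, Function.update_self]
        have e : ∑ i ∈ s, Function.update c j ((b x₀ - ∑ i ∈ s, c i * a i x₀) / a j x₀) i • a i =
            ∑ i ∈ s, c i • a i := Finset.sum_congr rfl fun i hi => by
          rw [Function.update_of_ne (ne_of_mem_of_not_mem hi hj)]
        rw [e]
        have hb' : b = ∑ i ∈ s, c i • (a i - (a i x₀ / a j x₀) • a j) + (b x₀ / a j x₀) • a j := by
          rw [← hb, sub_add_cancel]
        ext x
        have hx := LinearMap.congr_fun hb' x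
        simp only [LinearMap.add_apply, LinearMap.sum_apply, LinearMap.smul_apply,
          LinearMap.sub_apply, smul_eq_mul, mul_sub, Finset.sum_sub_distrib] at hx ⊢
        rw [hx]
        have e2 : ∑ i ∈ s, c i * (a i x₀ / a j x₀ * a j x) =
            (∑ i ∈ s, c i * a i x₀) / a j x₀ * a j x := by
          rw [Finset.sum_div, Finset.sum_mul]
          exact Finset.sum_congr rfl fun i _ => by ring
        rw [e2]
        ring

namespace ToricFan

variable {r : ℕ}

/-! ### Lattice points and rational cones -/

/-- The point of `N ⊗ ℝ` given by a lattice point. -/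
abbrev realVec (v : Fin r → ℤ) : Fin r → ℝ := fun i => (v i : ℝ)

theorem realVec_neg (v : Fin r → ℤ) : realVec (-v) = -realVec v := by
  ext i
  exact Int.cast_neg _

/-- The functional `x ↦ ⟨m, x⟩` on `N ⊗ ℝ` given by `m ∈ M`. -/
def pairingLin (m : Fin r → ℤ) : (Fin r → ℝ) →ₗ[ℝ] ℝ where
  toFun := pairing m
  map_add' := pairing_add_right m
  map_smul' := pairing_smul_right m

@[simp]
theorem pairing_zero_left (x : Fin r → ℝ) : pairing 0 x = 0 := by simp [pairing]

@[simp]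
theorem pairing_zero_right (m : Fin r → ℤ) : pairing m 0 = 0 := by simp [pairing]

theorem pairing_neg_right (m : Fin r → ℤ) (x : Fin r → ℝ) : pairing m (-x) = -pairing m x := by
  simp [pairing]

theorem pairing_sub_left (m m' : Fin r → ℤ) (x : Fin r → ℝ) :
    pairing (m - m') x = pairing m x - pairing m' x := by
  rw [sub_eq_add_neg, pairing_add_left, pairing_neg_left, sub_eq_add_neg]

theorem pairing_zsmul_left (n : ℤ) (m : Fin r → ℤ) (x : Fin r → ℝ) :
    pairing (n • m) x = n * pairing m x := by
  simp [pairing, Finset.mul_sum, mul_assoc]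

theorem pairing_sum_left {ι : Type*} (s : Finset ι) (f : ι → Fin r → ℤ) (x : Fin r → ℝ) :
    pairing (∑ i ∈ s, f i) x = ∑ i ∈ s, pairing (f i) x := by
  classical
  induction s using Finset.induction_on with
  | empty => simp
  | insert j s hj ih => rw [Finset.sum_insert hj, Finset.sum_insert hj, pairing_add_left, ih]

theorem exists_int_mul_eq (x : Fin r → ℚ) :
    ∃ N : ℕ, 0 < N ∧ ∃ m : Fin r → ℤ, ∀ i, (m i : ℚ) = N * x i := by
  refine ⟨∏ i, (x i).den, Finset.prod_pos fun i _ => (x i).den_pos,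
    fun i => (∏ j ∈ Finset.univ.erase i, ((x j).den : ℤ)) * (x i).num, fun i => ?_⟩
  rw [← Finset.mul_prod_erase Finset.univ _ (Finset.mem_univ i)]
  push_cast
  have := Rat.den_mul_eq_num (x i)
  rw [← this]; ring

/-- Farkas' lemma for lattice points: a lattice point outside a cone generated by lattice points is
separated from it by a functional in `M`. -/
theorem exists_pairing_neg_of_notMem_hull {V : Finset (Fin r → ℤ)} {b : Fin r → ℤ}
    (hb : realVec b ∉ PointedCone.hull ℝ (realVec '' (V : Set (Fin r → ℤ)))) :
    ∃ m : Fin r → ℤ, (∀ v ∈ V, 0 ≤ pairing m (realVec v)) ∧ pairing m (realVec b) < 0 := by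
  classical
  by_contra hcon
  push Not at hcon
  apply hb
  let a : (Fin r → ℤ) → Module.Dual ℚ (Fin r → ℚ) := fun v =>
    ∑ i, (v i : ℚ) • LinearMap.proj i
  have ha : ∀ v x, a v x = ∑ i, (v i : ℚ) * x i := fun v x => by simp [a]
  have key : ∀ (N : ℕ) (x : Fin r → ℚ) (m : Fin r → ℤ), (∀ i, (m i : ℚ) = N * x i) →
      ∀ v, pairing m (realVec v) = ((N * a v x : ℚ) : ℝ) := by
    intro N x m hm v
    have : ∀ i, (m i : ℝ) = ((m i : ℚ) : ℝ) := fun i => by simp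
    rw [ha, pairing, Finset.mul_sum, Rat.cast_sum]
    refine Finset.sum_congr rfl fun i _ => ?_
    rw [this, hm]; push_cast; ring
  obtain ⟨c, hc, hbc⟩ := exists_nonneg_combination_of_forall_nonneg V a (a b) (fun x hx => by
    obtain ⟨N, hN, m, hm⟩ := exists_int_mul_eq x
    have := hcon m fun v hv => by
      rw [key N x m hm v]
      exact_mod_cast mul_nonneg (Nat.cast_nonneg N) (hx v hv)
    rw [key N x m hm b] at this
    have h2 : 0 ≤ (N : ℚ) * a b x := by exact_mod_cast this
    exact nonneg_of_mul_nonneg_right h2 (by exact_mod_cast hN))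
  have hbsum : realVec b = ∑ v ∈ V, ((c v : ℚ) : ℝ) • realVec v := by
    ext i
    have := LinearMap.congr_fun hbc (Pi.single i 1)
    simp only [LinearMap.sum_apply, LinearMap.smul_apply, ha, smul_eq_mul, Pi.single_apply,
      mul_ite, mul_one, mul_zero, Finset.sum_ite_eq', Finset.mem_univ, if_true] at this
    rw [Finset.sum_apply]
    simp only [Pi.smul_apply, smul_eq_mul]
    have h2 : ((b i : ℚ) : ℝ) = ((∑ v ∈ V, c v * (v i : ℚ) : ℚ) : ℝ) := by rw [this]
    push_cast at h2
    exact h2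
  rw [hbsum]
  refine Submodule.sum_mem _ fun v hv => ?_
  exact Submodule.smul_mem _ (⟨((c v : ℚ) : ℝ), by exact_mod_cast hc v hv⟩ : {c : ℝ // 0 ≤ c})
    (PointedCone.subset_hull ⟨v, hv, rfl⟩)

/-- A lattice point outside a linear subspace spanned by lattice points is separated from it by a
functional in `M`. -/
theorem exists_pairing_pos_of_notMem_span {V : Finset (Fin r → ℤ)} {b : Fin r → ℤ}
    (hb : realVec b ∉ Submodule.span ℝ (realVec '' (V : Set (Fin r → ℤ)))) :
    ∃ m : Fin r → ℤ, (∀ v ∈ V, pairing m (realVec v) = 0) ∧ 0 < pairing m (realVec b) := by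
  classical
  obtain ⟨m, hm, hmb⟩ := exists_pairing_neg_of_notMem_hull (V := V ∪ V.image (-·)) (b := b)
    (fun h => hb (by
      refine (Submodule.span_le (p := (Submodule.span ℝ
        (realVec '' (V : Set (Fin r → ℤ)))).restrictScalars {c : ℝ // 0 ≤ c})).2 ?_ h
      rintro _ ⟨v, hv, rfl⟩
      change realVec v ∈ Submodule.span ℝ (realVec '' (V : Set (Fin r → ℤ)))
      rw [Finset.mem_coe, Finset.mem_union, Finset.mem_image] at hv
      rcases hv with hv | ⟨w, hw, rfl⟩
      · exact Submodule.subset_span ⟨v, hv, rfl⟩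
      · rw [realVec_neg]
        exact Submodule.neg_mem _ (Submodule.subset_span ⟨w, hw, rfl⟩)))
  refine ⟨-m, fun v hv => ?_, by rw [pairing_neg_left]; linarith⟩
  have h1 := hm v (Finset.mem_union_left _ hv)
  have h2 := hm (-v) (Finset.mem_union_right _ (Finset.mem_image_of_mem _ hv))
  rw [realVec_neg, pairing_neg_right] at h2
  rw [pairing_neg_left]
  linarith

/-! ### Faces of rational cones -/

theorem realVec_mem {V : Finset (Fin r → ℤ)} {v : Fin r → ℤ} (hv : v ∈ V) :
    realVec v ∈ PointedCone.hull ℝ (realVec '' (V : Set (Fin r → ℤ))) :=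
  PointedCone.subset_hull ⟨v, hv, rfl⟩

theorem span_hull (s : Set (Fin r → ℝ)) :
    Submodule.span ℝ (PointedCone.hull ℝ s : Set (Fin r → ℝ)) = Submodule.span ℝ s := by
  refine le_antisymm (Submodule.span_le.2 fun x hx => ?_)
    (Submodule.span_mono PointedCone.subset_hull)
  exact (Submodule.span_le (p := (Submodule.span ℝ s).restrictScalars {c : ℝ // 0 ≤ c})).2
    Submodule.subset_span hx

/-- A functional that is positive on the nonzero points of a strongly convex rational cone. -/
theorem exists_pairing_pos {σ : PointedCone ℝ (Fin r → ℝ)} (hσ : IsRational σ)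
    (hsc : ∀ x ∈ σ, -x ∈ σ → x = 0) :
    ∃ m : Fin r → ℤ, ∀ x ∈ σ, x ≠ 0 → 0 < pairing m x := by
  classical
  obtain ⟨V, rfl⟩ := hσ
  change ∀ x ∈ PointedCone.hull ℝ (realVec '' (V : Set (Fin r → ℤ))),
    -x ∈ PointedCone.hull ℝ (realVec '' (V : Set (Fin r → ℤ))) → x = 0 at hsc
  have h1 : ∀ v ∈ V, v ≠ 0 → ∃ m ∈ dualMonoid
      (PointedCone.hull ℝ (realVec '' (V : Set (Fin r → ℤ)))), 0 < pairing m (realVec v) := by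
    intro v hv hv0
    obtain ⟨m, hm, hmb⟩ := exists_pairing_neg_of_notMem_hull (V := V) (b := -v) (fun h => hv0 (by
      rw [realVec_neg] at h
      have := hsc _ (realVec_mem hv) h
      ext i
      have := congrFun this i
      simpa using this))
    refine ⟨m, mem_dualMonoid_hull.2 fun v hv => ?_, ?_⟩
    · have := hm v hv
      rw [pairing_intCast] at this
      exact_mod_cast this
    · rw [realVec_neg, pairing_neg_right] at hmb
      linarith
  choose! f hf hfpos using h1
  refine ⟨∑ v ∈ V with v ≠ 0, f v, fun x hx hx0 => ?_⟩
  change x ∈ PointedCone.hull ℝ (realVec '' (V : Set (Fin r → ℤ))) at hx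
  have hnn : ∀ v ∈ V.filter (· ≠ 0), ∀ y ∈ PointedCone.hull ℝ (realVec '' (V : Set (Fin r → ℤ))),
      0 ≤ pairing (f v) y := fun v hv y hy =>
    hf v (Finset.mem_filter.1 hv).1 (Finset.mem_filter.1 hv).2 y hy
  have : x = 0 ∨ 0 < pairing (∑ v ∈ V with v ≠ 0, f v) x := by
    clear hx0
    induction hx using Submodule.span_induction with
    | mem x hx =>
      obtain ⟨v, hv, rfl⟩ := hx
      by_cases hv0 : v = 0
      · left; ext i; simp [hv0]
      · right
        rw [pairing_sum_left]
        exact Finset.sum_pos' (fun w hw => hnn w hw _ (realVec_mem hv))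
          ⟨v, Finset.mem_filter.2 ⟨hv, hv0⟩, hfpos v hv hv0⟩
    | zero => exact Or.inl rfl
    | add x y hx hy ihx ihy =>
      rcases ihx with rfl | ihx
      · simpa using ihy
      · right
        rw [pairing_add_right]
        refine add_pos_of_pos_of_nonneg ihx ?_
        rw [pairing_sum_left]
        exact Finset.sum_nonneg fun v hv => hnn v hv y hy
    | smul a x hx ih =>
      rcases ih with rfl | ih
      · left; simp
      · rcases a.2.eq_or_lt with h | h
        · left
          change (a : ℝ) • x = 0
          rw [← h, zero_smul]
        · right
          change 0 < pairing _ ((a : ℝ) • x)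
          rw [pairing_smul_right]
          exact mul_pos h ih
  exact this.resolve_left hx0

/-- If `a ≥ 0` on a rational cone `σ`, and `b` takes a positive value on `σ` but none where `a`
vanishes, some combination `q a - p b` with `p, q > 0` is nonnegative on `σ` and vanishes at a point
of `σ` where `b` is positive. -/
theorem exists_tilt {σ : PointedCone ℝ (Fin r → ℝ)} (hσ : IsRational σ) {a b : Fin r → ℤ}
    (ha : a ∈ dualMonoid σ) (hab : ∀ x ∈ σ, pairing a x = 0 → pairing b x ≤ 0)
    (hb : ∃ x ∈ σ, 0 < pairing b x) :
    ∃ p q : ℤ, 0 < p ∧ 0 < q ∧ q • a - p • b ∈ dualMonoid σ ∧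
      ∃ x ∈ σ, pairing (q • a - p • b) x = 0 ∧ 0 < pairing b x := by
  classical
  obtain ⟨V, rfl⟩ := hσ
  have hV : (V.filter fun v => 0 < ∑ i, b i * v i).Nonempty := by
    by_contra hcon
    rw [Finset.not_nonempty_iff_eq_empty, Finset.filter_eq_empty_iff] at hcon
    obtain ⟨x, hx, hbx⟩ := hb
    have : -b ∈ dualMonoid (PointedCone.hull ℝ (realVec '' (V : Set (Fin r → ℤ)))) :=
      mem_dualMonoid_hull.2 fun v hv => by
        have := hcon hv
        simp only [Pi.neg_apply, neg_mul, Finset.sum_neg_distrib]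
        omega
    have := this x hx
    rw [pairing_neg_left] at this
    linarith
  obtain ⟨v₀, hv₀, hmax⟩ := Finset.exists_max_image _
    (fun v => ((∑ i, b i * v i : ℤ) : ℚ) / ((∑ i, a i * v i : ℤ) : ℚ)) hV
  have hapos : ∀ v ∈ V, 0 < ∑ i, b i * v i → 0 < ∑ i, a i * v i := by
    intro v hv hbv
    have h0 := mem_dualMonoid_hull.1 ha v hv
    refine h0.lt_of_ne fun h => ?_
    have := hab _ (realVec_mem hv) (by rw [pairing_intCast, ← h]; simp)
    rw [pairing_intCast] at this
    have : ∑ i, b i * v i ≤ 0 := by exact_mod_cast this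
    omega
  obtain ⟨hv₀V, hbv₀⟩ := Finset.mem_filter.1 hv₀
  have hav₀ := hapos v₀ hv₀V hbv₀
  refine ⟨∑ i, a i * v₀ i, ∑ i, b i * v₀ i, hav₀, hbv₀, mem_dualMonoid_hull.2 fun v hv => ?_,
    realVec v₀, realVec_mem hv₀V, ?_, ?_⟩
  · have e : ∑ i, ((∑ i, b i * v₀ i) • a - (∑ i, a i * v₀ i) • b) i * v i =
        (∑ i, b i * v₀ i) * (∑ i, a i * v i) - (∑ i, a i * v₀ i) * ∑ i, b i * v i := by
      simp only [Pi.sub_apply, Pi.smul_apply, smul_eq_mul, sub_mul, Finset.sum_sub_distrib,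
        Finset.mul_sum, mul_assoc]
    rw [e]
    have hav := mem_dualMonoid_hull.1 ha v hv
    by_cases hbv : 0 < ∑ i, b i * v i
    · have h1 := hmax v (Finset.mem_filter.2 ⟨hv, hbv⟩)
      have h2 := hapos v hv hbv
      rw [div_le_div_iff₀ (by exact_mod_cast h2) (by exact_mod_cast hav₀)] at h1
      have h3 : (∑ i, b i * v i) * ∑ i, a i * v₀ i ≤ (∑ i, b i * v₀ i) * ∑ i, a i * v i := by
        exact_mod_cast h1
      linarith
    · have : 0 ≤ (∑ i, b i * v₀ i) * (∑ i, a i * v i) := mul_nonneg hbv₀.le hav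
      have : (∑ i, a i * v₀ i) * ∑ i, b i * v i ≤ 0 :=
        mul_nonpos_of_nonneg_of_nonpos hav₀.le (not_lt.1 hbv)
      linarith
  · rw [pairing_sub_left, pairing_zsmul_left, pairing_zsmul_left, pairing_intCast, pairing_intCast]
    ring
  · rw [pairing_intCast]
    exact_mod_cast hbv₀

theorem pairing_eq_zero_of_mem_span {s : Set (Fin r → ℝ)} {m : Fin r → ℤ}
    (h : ∀ x ∈ s, pairing m x = 0) {x : Fin r → ℝ} (hx : x ∈ Submodule.span ℝ s) :
    pairing m x = 0 :=
  LinearMap.mem_ker.1 ((Submodule.span_le (p := LinearMap.ker (pairingLin m))).2 h hx)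

/-- A proper face has smaller dimension. -/
theorem coneDim_lt_of_isFace {τ σ : PointedCone ℝ (Fin r → ℝ)} (h : IsFace τ σ) (hne : τ ≠ σ) :
    coneDim τ < coneDim σ := by
  refine Submodule.finrank_lt_finrank_of_lt
    ((Submodule.span_mono (show (τ : Set (Fin r → ℝ)) ⊆ σ from h.le)).lt_of_ne fun he => hne ?_)
  obtain ⟨m, hm, hτ⟩ := h
  ext x
  refine ⟨fun hx => ((hτ x).1 hx).1, fun hx => (hτ x).2 ⟨hx, ?_⟩⟩
  refine pairing_eq_zero_of_mem_span (fun y hy => ((hτ y).1 hy).2) ?_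
  rw [he]
  exact Submodule.subset_span hx

theorem coneDim_le_of_le {τ σ : PointedCone ℝ (Fin r → ℝ)} (h : τ ≤ σ) :
    coneDim τ ≤ coneDim σ :=
  Submodule.finrank_mono (Submodule.span_mono h)

theorem coneDim_le (σ : PointedCone ℝ (Fin r → ℝ)) : coneDim σ ≤ r := by
  simpa [coneDim] using Submodule.finrank_le (Submodule.span ℝ (σ : Set (Fin r → ℝ)))

theorem coneDim_bot : coneDim (⊥ : PointedCone ℝ (Fin r → ℝ)) = 0 := by
  simp [coneDim]

theorem coneDim_eq_zero {σ : PointedCone ℝ (Fin r → ℝ)} : coneDim σ = 0 ↔ σ = ⊥ := by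
  refine ⟨fun h => ?_, fun h => h ▸ coneDim_bot⟩
  rw [coneDim, Submodule.finrank_eq_zero, Submodule.span_eq_bot] at h
  exact (Submodule.eq_bot_iff _).2 h

/-- The face `σ ∩ m^⊥` cut out by `m ∈ σ^∨ ∩ M`. -/
def faceOf (σ : PointedCone ℝ (Fin r → ℝ)) (m : Fin r → ℤ) : PointedCone ℝ (Fin r → ℝ) :=
  σ ⊓ (LinearMap.ker (pairingLin m)).restrictScalars {c : ℝ // 0 ≤ c}

theorem mem_faceOf {σ : PointedCone ℝ (Fin r → ℝ)} {m : Fin r → ℤ} {x : Fin r → ℝ} :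
    x ∈ faceOf σ m ↔ x ∈ σ ∧ pairing m x = 0 := Iff.rfl

theorem isFace_faceOf {σ : PointedCone ℝ (Fin r → ℝ)} {m : Fin r → ℤ} (hm : m ∈ dualMonoid σ) :
    IsFace (faceOf σ m) σ := ⟨m, hm, fun _ => mem_faceOf⟩

theorem isFace_bot {σ : PointedCone ℝ (Fin r → ℝ)} (hσ : IsRational σ)
    (hsc : ∀ x ∈ σ, -x ∈ σ → x = 0) : IsFace ⊥ σ := by
  obtain ⟨m, hm⟩ := exists_pairing_pos hσ hsc
  refine ⟨m, fun x hx => ?_, fun x => ?_⟩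
  · rcases eq_or_ne x 0 with rfl | h
    · simp
    · exact (hm x hx h).le
  · rw [Submodule.mem_bot]
    refine ⟨by rintro rfl; simp, fun h => ?_⟩
    by_contra h0
    exact (hm x h.1 h0).ne' h.2

/-- Between a cone and a face of codimension at least two there is another face. -/
theorem exists_face_between {τ σ : PointedCone ℝ (Fin r → ℝ)} (hσ : IsRational σ)
    (hτ : IsRational τ) (h : IsFace τ σ) (hdim : coneDim τ + 1 < coneDim σ) :
    ∃ τ', IsFace τ' σ ∧ τ < τ' ∧ τ' < σ := by
  classical
  have hσ' := hσ
  obtain ⟨V, rfl⟩ := hσ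
  obtain ⟨U, rfl⟩ := hτ
  obtain ⟨m, hm, hτ⟩ := h
  -- a generator outside the face, and a generator outside the span of the face and the first one
  have h1 : ∃ v ∈ V, 0 < pairing m (realVec v) := by
    by_contra! hcon
    have : ∀ x ∈ PointedCone.hull ℝ (realVec '' (V : Set (Fin r → ℤ))), pairing m x = 0 := by
      intro x hx
      refine pairing_eq_zero_of_mem_span (s := realVec '' (V : Set (Fin r → ℤ))) ?_ ?_
      · rintro _ ⟨v, hv, rfl⟩
        exact le_antisymm (hcon v hv) (hm _ (realVec_mem hv))
      · rw [← span_hull]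
        exact Submodule.subset_span hx
    have hle := coneDim_le_of_le (show PointedCone.hull ℝ (realVec '' (V : Set (Fin r → ℤ))) ≤
      PointedCone.hull ℝ (realVec '' (U : Set (Fin r → ℤ))) from
        fun x hx => (hτ x).2 ⟨hx, this x hx⟩)
    change coneDim (PointedCone.hull ℝ (realVec '' (U : Set (Fin r → ℤ)))) + 1 <
      coneDim (PointedCone.hull ℝ (realVec '' (V : Set (Fin r → ℤ)))) at hdim
    omega
  obtain ⟨v₁, hv₁, hmv₁⟩ := h1
  have h2 : ∃ w ∈ V, realVec w ∉
      Submodule.span ℝ (realVec '' ((insert v₁ U : Finset (Fin r → ℤ)) : Set (Fin r → ℤ))) := by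
    by_contra! hcon
    have hle : Submodule.span ℝ (realVec '' (V : Set (Fin r → ℤ))) ≤
        Submodule.span ℝ (realVec '' ((insert v₁ U : Finset (Fin r → ℤ)) : Set (Fin r → ℤ))) := by
      rw [Submodule.span_le]
      rintro _ ⟨w, hw, rfl⟩
      exact hcon w hw
    have hle := Submodule.finrank_mono hle
    rw [Finset.coe_insert, Set.image_insert_eq, Submodule.span_insert] at hle
    have h3 := Submodule.finrank_add_le_finrank_add_finrank (Submodule.span ℝ {realVec v₁})
      (Submodule.span ℝ (realVec '' (U : Set (Fin r → ℤ))))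
    have h4 := finrank_span_le_card (R := ℝ) ({realVec v₁} : Set (Fin r → ℝ))
    rw [Set.toFinset_singleton, Finset.card_singleton] at h4
    simp only [coneDim] at hdim
    rw [span_hull, span_hull] at hdim
    change Module.finrank ℝ (Submodule.span ℝ (realVec '' (U : Set (Fin r → ℤ)))) + 1 <
      Module.finrank ℝ (Submodule.span ℝ (realVec '' (V : Set (Fin r → ℤ)))) at hdim
    omega
  obtain ⟨w, hw, hwspan⟩ := h2
  obtain ⟨m', hm', hm'w⟩ := exists_pairing_pos_of_notMem_span hwspan
  obtain ⟨p, q, hp, hq, hmem, x, hx, hx0, hm'x⟩ := exists_tilt hσ' (a := m) (b := m') hm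
    (fun x hx hmx => by
      refine (pairing_eq_zero_of_mem_span (s := realVec '' (U : Set (Fin r → ℤ))) ?_ ?_).le
      · rintro _ ⟨u, hu, rfl⟩
        exact hm' u (Finset.mem_insert_of_mem hu)
      · rw [← span_hull]
        exact Submodule.subset_span ((hτ x).2 ⟨hx, hmx⟩))
    ⟨_, realVec_mem hw, hm'w⟩
  have hU : ∀ y ∈ PointedCone.hull ℝ (realVec '' (U : Set (Fin r → ℤ))), pairing m' y = 0 := by
    intro y hy
    refine pairing_eq_zero_of_mem_span (s := realVec '' (U : Set (Fin r → ℤ))) ?_ ?_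
    · rintro _ ⟨u, hu, rfl⟩
      exact hm' u (Finset.mem_insert_of_mem hu)
    · rw [← span_hull]
      exact Submodule.subset_span hy
  refine ⟨_, isFace_faceOf hmem, lt_of_le_not_ge (fun y hy => mem_faceOf.2 ⟨((hτ y).1 hy).1, ?_⟩)
    (fun hle => ?_), lt_of_le_not_ge (fun y hy => (mem_faceOf.1 hy).1) (fun hle => ?_)⟩
  · rw [pairing_sub_left, pairing_zsmul_left, pairing_zsmul_left, ((hτ y).1 hy).2, hU y hy]
    ring
  · exact hm'x.ne' (hU x (hle (mem_faceOf.2 ⟨hx, hx0⟩)))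
  · have := (mem_faceOf.1 (hle (realVec_mem hv₁))).2
    rw [pairing_sub_left, pairing_zsmul_left, pairing_zsmul_left,
      hm' v₁ (Finset.mem_insert_self _ _), mul_zero, sub_zero] at this
    have h5 : (0 : ℝ) < q * pairing m (realVec v₁) := mul_pos (by exact_mod_cast hq) hmv₁
    exact h5.ne' this

/-! ### Cones of a fan -/

section FanCones

variable (Δ : ToricFan r)

instance : Finite Δ.Cone := Δ.finite.to_subtype

theorem bot_mem : (⊥ : PointedCone ℝ (Fin r → ℝ)) ∈ Δ.cones := by
  obtain ⟨σ, hσ⟩ := Δ.nonempty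
  exact Δ.face_mem σ hσ _ (isFace_bot (Δ.rational σ hσ) (Δ.stronglyConvex σ hσ))

/-- The zero cone. -/
def zeroCone : Δ.Cone := ⟨⊥, Δ.bot_mem⟩

variable {Δ}

theorem zeroCone_le (σ : Δ.Cone) : Δ.zeroCone ≤ σ :=
  show (⊥ : PointedCone ℝ (Fin r → ℝ)) ≤ σ.1 from bot_le

theorem eq_zeroCone_iff {σ : Δ.Cone} : σ = Δ.zeroCone ↔ coneDim σ.1 = 0 := by
  rw [coneDim_eq_zero]
  exact Subtype.ext_iff

theorem coneDim_strictMono : StrictMono fun σ : Δ.Cone => coneDim σ.1 := fun _ _ h =>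
  coneDim_lt_of_isFace (isFace_of_le h.le) fun he => h.ne (Subtype.ext he)

/-- A nonzero cone of a fan has a facet. -/
theorem exists_facet (σ : Δ.Cone) {n : ℕ} (hn : coneDim σ.1 = n + 1) :
    ∃ τ : Δ.Cone, τ < σ ∧ coneDim τ.1 = n := by
  have h0 : Δ.zeroCone < σ := (zeroCone_le σ).lt_of_ne fun h => by
    have := eq_zeroCone_iff.1 h.symm
    omega
  obtain ⟨τ, hτ, hmax⟩ := Set.exists_max_image {τ : Δ.Cone | τ < σ} (fun τ => coneDim τ.1)
    (Set.toFinite _) ⟨_, h0⟩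
  refine ⟨τ, hτ, ?_⟩
  have hlt : coneDim τ.1 < coneDim σ.1 := coneDim_strictMono (Δ := Δ) hτ
  by_contra hne
  obtain ⟨τ', hf, h1, h2⟩ := exists_face_between (Δ.rational _ σ.2) (Δ.rational _ τ.2)
    (isFace_of_le (le_of_lt hτ)) (by omega)
  have h3 := hmax ⟨τ', Δ.face_mem _ σ.2 _ hf⟩ h2
  have h4 : coneDim τ.1 < coneDim τ' :=
    coneDim_strictMono (Δ := Δ) (a := τ) (b := ⟨τ', Δ.face_mem _ σ.2 _ hf⟩) h1
  exact absurd h4 (not_lt.2 h3)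

/-- The dimension of a cone is its height in the poset of cones. -/
theorem height_eq_coneDim (σ : Δ.Cone) : Order.height σ = coneDim σ.1 := by
  refine le_antisymm ?_ ?_
  · have := Order.height_le_height_apply_of_strictMono _ (coneDim_strictMono (Δ := Δ)) σ
    rwa [Order.height_nat] at this
  · obtain ⟨n, hn⟩ : ∃ n, coneDim σ.1 = n := ⟨_, rfl⟩
    rw [hn]
    induction n generalizing σ with
    | zero => simp
    | succ n ih =>
      obtain ⟨τ, hτ, hτn⟩ := exists_facet σ hn
      push_cast
      exact (add_le_add_left (ih τ hτn) 1).trans (Order.height_add_one_le hτ)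

variable (Δ) in
/-- Induction on the dimension of `σ`: if `m` were positive somewhere on `σ`, tilting a functional
that is positive on `σ` by `m` would cut out a face on which `m` takes a positive value. -/
theorem pairing_nonpos_of_rays (n : ℕ) : ∀ σ ∈ Δ.cones, coneDim σ = n → ∀ m : Fin r → ℤ,
    (∀ ρ ∈ Δ.cones, coneDim ρ = 1 → ∀ x ∈ ρ, pairing m x = 0) → ∀ x ∈ σ, pairing m x ≤ 0 := by
  induction n using Nat.strong_induction_on with
  | _ n ih =>
  intro σ hσ hn m hm x hx
  rcases Nat.lt_or_ge n 2 with hn2 | hn2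
  · interval_cases n
    · rw [coneDim_eq_zero] at hn
      rw [hn, Submodule.mem_bot] at hx
      simp [hx]
    · exact (hm σ hσ hn x hx).le
  · by_contra! hpos
    obtain ⟨m₀, hm₀⟩ := exists_pairing_pos (Δ.rational σ hσ) (Δ.stronglyConvex σ hσ)
    obtain ⟨p, q, hp, hq, hmem, x₀, hx₀, h0, hmx₀⟩ := exists_tilt (Δ.rational σ hσ)
      (a := m₀) (b := m) (fun y hy => by
        rcases eq_or_ne y 0 with rfl | h
        · simp
        · exact (hm₀ y hy h).le)
      (fun y hy h => by
        have : y = 0 := by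
          by_contra h'
          exact (hm₀ y hy h').ne' h
        simp [this]) ⟨x, hx, hpos⟩
    have hface := isFace_faceOf hmem
    have hfmem := Δ.face_mem σ hσ _ hface
    by_cases he : faceOf σ (q • m₀ - p • m) = σ
    · -- here `m` is a positive multiple of `m₀` on `σ`, hence positive on every nonzero face
      obtain ⟨τ, hτ, h1, h2⟩ := exists_face_between (Δ.rational σ hσ) (Δ.rational _ Δ.bot_mem)
        (isFace_bot (Δ.rational σ hσ) (Δ.stronglyConvex σ hσ)) (by rw [coneDim_bot]; omega)
      obtain ⟨y, hy, hy0⟩ := Submodule.exists_mem_ne_zero_of_ne_bot h1.ne'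
      have hyσ : y ∈ σ := h2.le hy
      have h3 := ih (coneDim τ) (hn ▸ coneDim_lt_of_isFace hτ h2.ne) τ
        (Δ.face_mem σ hσ _ hτ) rfl m hm y hy
      have h4 := (mem_faceOf.1 (he.symm ▸ hyσ)).2
      rw [pairing_sub_left, pairing_zsmul_left, pairing_zsmul_left] at h4
      have h5 : (0 : ℝ) < q * pairing m₀ y := mul_pos (by exact_mod_cast hq) (hm₀ y hyσ hy0)
      have h6 : (p : ℝ) * pairing m y ≤ 0 :=
        mul_nonpos_of_nonneg_of_nonpos (by exact_mod_cast hp.le) h3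
      linarith
    · have := ih (coneDim (faceOf σ (q • m₀ - p • m))) (hn ▸ coneDim_lt_of_isFace hface he) _
        hfmem rfl m hm x₀ (mem_faceOf.2 ⟨hx₀, h0⟩)
      linarith

variable (Δ) in
/-- The subgroup `|Δ|^⊥ ∩ M` of `M`. -/
def orthogonalLattice : Submodule ℤ (Fin r → ℤ) where
  carrier := {m | ∀ σ ∈ Δ.cones, ∀ x ∈ σ, pairing m x = 0}
  zero_mem' := fun _ _ _ _ => pairing_zero_left _
  add_mem' := fun ha hb σ hσ x hx => by
    rw [pairing_add_left, ha σ hσ x hx, hb σ hσ x hx, add_zero]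
  smul_mem' := fun n m hm σ hσ x hx => by rw [pairing_zsmul_left, hm σ hσ x hx, mul_zero]

theorem mem_orthogonalLattice {m : Fin r → ℤ} :
    m ∈ Δ.orthogonalLattice ↔ ∀ σ ∈ Δ.cones, ∀ x ∈ σ, pairing m x = 0 := Iff.rfl

/-- A functional that vanishes on the rays of a fan vanishes on all cones, since a strongly convex
rational cone is spanned by its rays. -/
theorem mem_orthogonalLattice_iff_rays {m : Fin r → ℤ} :
    m ∈ Δ.orthogonalLattice ↔ ∀ ρ ∈ Δ.cones, coneDim ρ = 1 → ∀ x ∈ ρ, pairing m x = 0 := by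
  refine ⟨fun h ρ hρ _ => h ρ hρ, fun h σ hσ x hx => le_antisymm
    (Δ.pairing_nonpos_of_rays _ σ hσ rfl m h x hx) ?_⟩
  have := Δ.pairing_nonpos_of_rays _ σ hσ rfl (-m)
    (fun ρ hρ h1 y hy => by rw [pairing_neg_left, h ρ hρ h1 y hy, neg_zero]) x hx
  rw [pairing_neg_left] at this
  linarith

theorem spanDim_le (Δ : ToricFan r) : Δ.spanDim ≤ r := by
  simpa [spanDim] using Submodule.finrank_le (Submodule.span ℝ Δ.support)

theorem spanDim_eq_of_exists {Δ : ToricFan r} (h : ∃ σ ∈ Δ.cones, coneDim σ = r) :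
    Δ.spanDim = r := by
  refine le_antisymm Δ.spanDim_le ?_
  obtain ⟨σ, hσ, h⟩ := h
  nth_rw 1 [← h]
  exact Submodule.finrank_mono (Submodule.span_mono (Set.subset_biUnion_of_mem
    (u := fun σ : PointedCone ℝ (Fin r → ℝ) => (σ : Set (Fin r → ℝ))) hσ))

/-- A real vector space is not a finite union of proper subspaces. -/
theorem IsComplete.exists_coneDim_eq {Δ : ToricFan r} (h : Δ.IsComplete) :
    ∃ σ ∈ Δ.cones, coneDim σ = r := by
  by_contra! hcon
  let s : Finset (Subspace ℝ (Fin r → ℝ)) :=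
    (Δ.finite.image fun σ : PointedCone ℝ (Fin r → ℝ) =>
      Submodule.span ℝ (σ : Set (Fin r → ℝ))).toFinset
  refine Subspace.biUnion_ne_univ_of_top_notMem (s := s) (fun htop => ?_) ?_
  · rw [Set.Finite.mem_toFinset] at htop
    obtain ⟨σ, hσ, he⟩ := htop
    refine hcon σ hσ ?_
    simp only at he
    rw [coneDim, he, finrank_top, Module.finrank_fin_fun]
  · rw [Set.eq_univ_iff_forall]
    intro x
    have hx : x ∈ Δ.support := by rw [h]; trivial
    obtain ⟨σ, hσ, hxσ⟩ := Set.mem_iUnion₂.1 hx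
    exact Set.mem_iUnion₂.2 ⟨_, (Set.Finite.mem_toFinset _).2 ⟨σ, hσ, rfl⟩,
      Submodule.subset_span hxσ⟩

end FanCones

/-! ### The topology of the set of cones -/

section FanTopology

variable {Δ Δ' : ToricFan r}

theorem isFace_iff_le {τ σ : Δ.Cone} : IsFace τ.1 σ.1 ↔ τ ≤ σ :=
  ⟨fun h => h.le, isFace_of_le⟩

theorem isOpen_iff_isLowerSet {s : Set Δ.Cone} : IsOpen s ↔ IsLowerSet s :=
  ⟨fun h _ _ hle hσ => h _ hσ _ (isFace_of_le hle), fun h _ hσ _ hf => h (isFace_iff_le.1 hf) hσ⟩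

theorem specializes_iff_le {τ σ : Δ.Cone} : τ ⤳ σ ↔ τ ≤ σ := by
  rw [specializes_iff_forall_open]
  refine ⟨fun h => ?_, fun h s hs hσ => isOpen_iff_isLowerSet.1 hs h hσ⟩
  exact h (Set.Iic σ) (isOpen_iff_isLowerSet.2 (isLowerSet_Iic σ)) (Set.mem_Iic.2 le_rfl)

/-- A homeomorphism between the spaces of cones of two fans is an isomorphism of posets. -/
def orderIsoOfHomeomorph (e : Δ.Cone ≃ₜ Δ'.Cone) : Δ.Cone ≃o Δ'.Cone where
  toEquiv := e.toEquiv
  map_rel_iff' {τ σ} := by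
    rw [← specializes_iff_le, ← specializes_iff_le]
    exact e.isInducing.specializes_iff

/-- An isomorphism between the posets of cones of two fans is a homeomorphism. -/
def homeomorphOfOrderIso (e : Δ.Cone ≃o Δ'.Cone) : Δ.Cone ≃ₜ Δ'.Cone where
  toEquiv := e.toEquiv
  continuous_toFun := ⟨fun _ hs => isOpen_iff_isLowerSet.2 fun _ _ hle hσ =>
    isOpen_iff_isLowerSet.1 hs (e.monotone hle) hσ⟩
  continuous_invFun := ⟨fun _ hs => isOpen_iff_isLowerSet.2 fun _ _ hle hσ =>
    isOpen_iff_isLowerSet.1 hs (e.symm.monotone hle) hσ⟩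

theorem coneDim_orderIso (e : Δ.Cone ≃o Δ'.Cone) (σ : Δ.Cone) :
    coneDim (e σ).1 = coneDim σ.1 := by
  have := Order.height_orderIso e σ
  rw [height_eq_coneDim, height_eq_coneDim] at this
  exact_mod_cast this

theorem numRays_eq_card (Δ : ToricFan r) :
    Δ.numRays = Nat.card {σ : Δ.Cone // coneDim σ.1 = 1} := by
  rw [numRays, ← Nat.card_coe_set_eq]
  exact Nat.card_congr
    { toFun := fun σ => ⟨⟨σ.1, σ.2.1⟩, σ.2.2⟩
      invFun := fun σ => ⟨σ.1.1, σ.1.2, σ.2⟩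
      left_inv := fun _ => rfl
      right_inv := fun _ => rfl }

theorem numRays_eq_of_homeomorph (e : Δ.Cone ≃ₜ Δ'.Cone) : Δ'.numRays = Δ.numRays := by
  rw [numRays_eq_card, numRays_eq_card]
  exact (Nat.card_congr ((orderIsoOfHomeomorph e).toEquiv.subtypeEquiv fun σ => by
    change _ ↔ coneDim (orderIsoOfHomeomorph e σ).1 = 1
    rw [coneDim_orderIso])).symm

theorem exists_coneDim_eq_of_homeomorph (e : Δ.Cone ≃ₜ Δ'.Cone)
    (h : ∃ σ ∈ Δ.cones, coneDim σ = r) : ∃ σ ∈ Δ'.cones, coneDim σ = r := by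
  obtain ⟨σ, hσ, h⟩ := h
  exact ⟨_, (orderIsoOfHomeomorph e ⟨σ, hσ⟩).2, (coneDim_orderIso _ _).trans h⟩

/-- The finite space `Δ_top` is sober. -/
theorem exists_closure_singleton_eq {Z : Set Δ.Cone} (hZ : IsIrreducible Z) (hc : IsClosed Z) :
    ∃ σ, closure {σ} = Z := by
  classical
  obtain ⟨t, ht, hsub⟩ := isIrreducible_iff_sUnion_isClosed.1 hZ
    ((Set.toFinite Z).toFinset.image fun σ => closure {σ}) (fun z hz => by
      obtain ⟨σ, -, rfl⟩ := Finset.mem_image.1 hz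
      exact isClosed_closure) (fun σ hσ => by
      refine Set.mem_sUnion.2 ⟨closure {σ}, ?_, subset_closure rfl⟩
      exact Finset.mem_coe.2 (Finset.mem_image.2 ⟨σ, (Set.Finite.mem_toFinset _).2 hσ, rfl⟩))
  obtain ⟨σ, hσ, rfl⟩ := Finset.mem_image.1 ht
  exact ⟨σ, (closure_minimal (Set.singleton_subset_iff.2
    ((Set.Finite.mem_toFinset _).1 hσ)) hc).antisymm hsub⟩

/-- The generic points of a chain of irreducible closed subsets form a decreasing chain of cones, so
a chain of length `r` starts at a cone of dimension `r`. -/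
theorem exists_coneDim_eq_of_topologicalKrullDim (h : topologicalKrullDim Δ.Cone = r) :
    ∃ σ ∈ Δ.cones, coneDim σ = r := by
  choose g hg using fun Z : TopologicalSpace.IrreducibleCloseds Δ.Cone =>
    exists_closure_singleton_eq Z.isIrreducible Z.isClosed
  have hmono : StrictMono fun Z => r - coneDim (g Z).1 := by
    intro Z W hlt
    have hle : g W ≤ g Z := by
      rw [← specializes_iff_le, specializes_iff_mem_closure, hg]
      exact hlt.le (by
        change g Z ∈ (Z : Set Δ.Cone)
        rw [← hg]
        exact subset_closure rfl)
    have hne : g W ≠ g Z := fun he => hlt.ne (SetLike.coe_injective (by rw [← hg, ← hg W, he]))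
    have h1 : coneDim (g W).1 < coneDim (g Z).1 := coneDim_strictMono (Δ := Δ) (hle.lt_of_ne hne)
    have h2 := coneDim_le (g Z).1
    change r - coneDim (g Z).1 < r - coneDim (g W).1
    omega
  obtain ⟨l, hl⟩ := Order.le_krullDim_iff.1 h.ge
  have h1 := (l.map _ hmono).head_add_length_le_nat
  have h2 : (l.map _ hmono).head = r - coneDim (g l.head).1 := rfl
  have h3 : (l.map _ hmono).last = r - coneDim (g l.last).1 := rfl
  have h4 : (l.map _ hmono).length = r := hl
  refine ⟨_, (g l.head).2, ?_⟩
  have h5 := coneDim_le (g l.head).1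
  omega

end FanTopology

/-! ### Two fans with homeomorphic spaces and different spans -/

section TwoRays

/-- The ray generated by a lattice point. -/
def rayCone (v : Fin r → ℤ) : PointedCone ℝ (Fin r → ℝ) := PointedCone.hull ℝ {realVec v}

theorem mem_rayCone {v : Fin r → ℤ} {x : Fin r → ℝ} :
    x ∈ rayCone v ↔ ∃ c : ℝ, 0 ≤ c ∧ c • realVec v = x := by
  refine Submodule.mem_span_singleton.trans ⟨?_, ?_⟩
  · rintro ⟨c, rfl⟩
    exact ⟨c, c.2, rfl⟩
  · rintro ⟨c, hc, rfl⟩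
    exact ⟨⟨c, hc⟩, rfl⟩

theorem isRational_rayCone (v : Fin r → ℤ) : IsRational (rayCone v) :=
  ⟨{v}, by rw [Finset.coe_singleton, Set.image_singleton]; rfl⟩

theorem isRational_bot : IsRational (⊥ : PointedCone ℝ (Fin r → ℝ)) :=
  ⟨∅, by rw [Finset.coe_empty, Set.image_empty]; exact Submodule.span_empty.symm⟩

theorem realVec_ne_zero {v : Fin r → ℤ} (hv : v ≠ 0) : realVec v ≠ 0 := fun h => hv (by
  ext i
  have := congrFun h i
  simpa using this)

theorem stronglyConvex_rayCone {v : Fin r → ℤ} (hv : v ≠ 0) :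
    ∀ x ∈ rayCone v, -x ∈ rayCone v → x = 0 := by
  intro x hx hx'
  obtain ⟨c, hc, rfl⟩ := mem_rayCone.1 hx
  obtain ⟨d, hd, he⟩ := mem_rayCone.1 hx'
  have : (d + c) • realVec v = 0 := by rw [add_smul, he, neg_add_cancel]
  have : d + c = 0 := (smul_eq_zero.1 this).resolve_right (realVec_ne_zero hv)
  have : c = 0 := by linarith
  rw [this, zero_smul]

theorem isFace_refl (σ : PointedCone ℝ (Fin r → ℝ)) : IsFace σ σ :=
  ⟨0, fun x _ => by simp, fun x => by simp⟩

theorem eq_or_eq_of_isFace_rayCone {v : Fin r → ℤ} {τ : PointedCone ℝ (Fin r → ℝ)}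
    (h : IsFace τ (rayCone v)) : τ = ⊥ ∨ τ = rayCone v := by
  obtain ⟨m, -, h⟩ := h
  by_cases hm : pairing m (realVec v) = 0
  · right
    ext x
    rw [h]
    refine ⟨fun hx => hx.1, fun hx => ⟨hx, ?_⟩⟩
    obtain ⟨c, -, rfl⟩ := mem_rayCone.1 hx
    rw [pairing_smul_right, hm, mul_zero]
  · left
    ext x
    rw [h, Submodule.mem_bot]
    refine ⟨fun ⟨hx, hmx⟩ => ?_, by rintro rfl; simp⟩
    obtain ⟨c, -, rfl⟩ := mem_rayCone.1 hx
    rw [pairing_smul_right] at hmx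
    rw [(mul_eq_zero.1 hmx).resolve_right hm, zero_smul]

/-- The fan consisting of two rays and the zero cone. -/
def twoRayFan (v w : Fin r → ℤ) (hv : v ≠ 0) (hw : w ≠ 0) (h : rayCone v ⊓ rayCone w = ⊥) :
    ToricFan r where
  cones := {⊥, rayCone v, rayCone w}
  finite := Set.toFinite _
  nonempty := ⟨⊥, by simp⟩
  rational := by
    rintro σ (rfl | rfl | rfl)
    exacts [isRational_bot, isRational_rayCone v, isRational_rayCone w]
  stronglyConvex := by
    rintro σ (rfl | rfl | rfl)
    exacts [fun x hx _ => by simpa using hx, stronglyConvex_rayCone hv, stronglyConvex_rayCone hw]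
  face_mem := by
    rintro σ (rfl | rfl | rfl) τ hτ
    · exact Or.inl (le_bot_iff.1 hτ.le)
    · exact (eq_or_eq_of_isFace_rayCone hτ).imp id Or.inl
    · exact (eq_or_eq_of_isFace_rayCone hτ).imp id Or.inr
  inter_isFace := by
    have hbv := isFace_bot (isRational_rayCone v) (stronglyConvex_rayCone hv)
    have hbw := isFace_bot (isRational_rayCone w) (stronglyConvex_rayCone hw)
    rintro σ (rfl | rfl | rfl) τ (rfl | rfl | rfl) <;>
      simp only [bot_inf_eq, inf_bot_eq, inf_idem, h, inf_comm (rayCone w) (rayCone v)] <;>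
      simp only [isFace_refl, hbv, hbw, and_self]

variable {v w : Fin r → ℤ} {hv : v ≠ 0} {hw : w ≠ 0} {h : rayCone v ⊓ rayCone w = ⊥}

theorem rayCone_ne_bot (hv : v ≠ 0) : rayCone v ≠ ⊥ := fun he => realVec_ne_zero hv (by
  have : realVec v ∈ rayCone v := mem_rayCone.2 ⟨1, zero_le_one, one_smul _ _⟩
  rw [he] at this
  simpa using this)

/-- The cones of the fan with two rays, indexed by `Option Bool`. -/
def twoRayCone (v w : Fin r → ℤ) : Option Bool → PointedCone ℝ (Fin r → ℝ)
  | none => ⊥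
  | some true => rayCone v
  | some false => rayCone w

theorem twoRayCone_le_iff (hv : v ≠ 0) (hw : w ≠ 0) (h : rayCone v ⊓ rayCone w = ⊥)
    (a b : Option Bool) : twoRayCone v w a ≤ twoRayCone v w b ↔ a = none ∨ a = b := by
  have h1 : ¬ rayCone v ≤ rayCone w := fun hle =>
    rayCone_ne_bot hv (by rw [← h, inf_eq_left.2 hle])
  have h2 : ¬ rayCone w ≤ rayCone v := fun hle =>
    rayCone_ne_bot hw (by rw [← h, inf_eq_right.2 hle])
  rcases a with _ | _ | _ <;> rcases b with _ | _ | _ <;>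
    simp [twoRayCone, h1, h2, rayCone_ne_bot hv, rayCone_ne_bot hw]

/-- The bijection between `Option Bool` and the cones of the fan with two rays. -/
noncomputable def twoRayEquiv (v w : Fin r → ℤ) (hv : v ≠ 0) (hw : w ≠ 0)
    (h : rayCone v ⊓ rayCone w = ⊥) : Option Bool ≃ (twoRayFan v w hv hw h).Cone :=
  Equiv.ofBijective (fun a => ⟨twoRayCone v w a, by
      rcases a with _ | _ | _
      exacts [Or.inl rfl, Or.inr (Or.inr rfl), Or.inr (Or.inl rfl)]⟩) <| by
    refine ⟨fun a b hab => ?_, ?_⟩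
    · have he : twoRayCone v w a = twoRayCone v w b := congrArg Subtype.val hab
      have h1 := (twoRayCone_le_iff hv hw h a b).1 he.le
      have h2 := (twoRayCone_le_iff hv hw h b a).1 he.ge
      rcases h1 with rfl | h1
      · rcases h2 with rfl | h2
        exacts [rfl, h2.symm]
      · exact h1
    · rintro ⟨σ, rfl | rfl | rfl⟩
      exacts [⟨none, rfl⟩, ⟨some true, rfl⟩, ⟨some false, rfl⟩]

theorem nonempty_homeomorph_twoRayFan {v' w' : Fin r → ℤ} (hv : v ≠ 0) (hw : w ≠ 0)
    (h : rayCone v ⊓ rayCone w = ⊥) (hv' : v' ≠ 0) (hw' : w' ≠ 0)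
    (h' : rayCone v' ⊓ rayCone w' = ⊥) :
    Nonempty ((twoRayFan v w hv hw h).Cone ≃ₜ (twoRayFan v' w' hv' hw' h').Cone) := by
  refine ⟨homeomorphOfOrderIso
    { toEquiv := (twoRayEquiv v w hv hw h).symm.trans (twoRayEquiv v' w' hv' hw' h')
      map_rel_iff' := fun {σ τ} => ?_ }⟩
  obtain ⟨a, rfl⟩ := (twoRayEquiv v w hv hw h).surjective σ
  obtain ⟨b, rfl⟩ := (twoRayEquiv v w hv hw h).surjective τ
  simp only [Equiv.trans_apply, Equiv.symm_apply_apply]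
  exact (twoRayCone_le_iff hv' hw' h' a b).trans (twoRayCone_le_iff hv hw h a b).symm

theorem spanDim_twoRayFan :
    (twoRayFan v w hv hw h).spanDim =
      Module.finrank ℝ (Submodule.span ℝ ({realVec v, realVec w} : Set (Fin r → ℝ))) := by
  have : Submodule.span ℝ (twoRayFan v w hv hw h).support =
      Submodule.span ℝ {realVec v, realVec w} := by
    refine le_antisymm (Submodule.span_le.2 fun x hx => ?_) (Submodule.span_mono ?_)
    · obtain ⟨σ, hσ, hx⟩ := Set.mem_iUnion₂.1 hx
      rcases hσ with rfl | rfl | rfl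
      · rw [show x = 0 by simpa using hx]
        exact Submodule.zero_mem _
      · obtain ⟨c, -, rfl⟩ := mem_rayCone.1 hx
        exact Submodule.smul_mem _ _ (Submodule.subset_span (by simp))
      · obtain ⟨c, -, rfl⟩ := mem_rayCone.1 hx
        exact Submodule.smul_mem _ _ (Submodule.subset_span (by simp))
    · rintro _ (rfl | rfl)
      · exact Set.mem_iUnion₂.2 ⟨rayCone v, Or.inr (Or.inl rfl),
          mem_rayCone.2 ⟨1, zero_le_one, one_smul _ _⟩⟩
      · exact Set.mem_iUnion₂.2 ⟨rayCone w, Or.inr (Or.inr rfl),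
          mem_rayCone.2 ⟨1, zero_le_one, one_smul _ _⟩⟩
  rw [spanDim, this]

/-- For `r ≥ 2`, the fans with rays through `e₀, e₁`, and through `e₀, -e₀`, have homeomorphic
spaces of cones, but spans of different dimensions. -/
theorem exists_homeomorph_spanDim_ne (hr : 2 ≤ r) :
    ∃ Δ Δ' : ToricFan r, Nonempty (Δ.Cone ≃ₜ Δ'.Cone) ∧ Δ'.spanDim < Δ.spanDim := by
  let i : Fin r := ⟨0, by omega⟩
  let j : Fin r := ⟨1, by omega⟩
  have hij : i ≠ j := by simp [i, j, Fin.ext_iff]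
  let a : Fin r → ℤ := Pi.single i 1
  let b : Fin r → ℤ := Pi.single j 1
  have ha : a ≠ 0 := by simp [a]
  have hb : b ≠ 0 := by simp [b]
  have h1 : rayCone a ⊓ rayCone b = ⊥ := by
    refine le_bot_iff.1 fun x hx => ?_
    obtain ⟨c, -, rfl⟩ := mem_rayCone.1 hx.1
    obtain ⟨d, -, he⟩ := mem_rayCone.1 hx.2
    have := congrFun he i
    simp [realVec, a, b, hij] at this
    simp [← this]
  have h2 : rayCone a ⊓ rayCone (-a) = ⊥ := by
    refine le_bot_iff.1 fun x hx => ?_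
    obtain ⟨c, hc, rfl⟩ := mem_rayCone.1 hx.1
    obtain ⟨d, hd, he⟩ := mem_rayCone.1 hx.2
    have := congrFun he i
    simp [realVec, a] at this
    have : c = 0 := by linarith
    simp [this]
  refine ⟨twoRayFan a b ha hb h1, twoRayFan a (-a) ha (neg_ne_zero.2 ha) h2,
    nonempty_homeomorph_twoRayFan _ _ _ _ _ _, ?_⟩
  rw [spanDim_twoRayFan, spanDim_twoRayFan]
  have hli : LinearIndependent ℝ ![realVec a, realVec b] := by
    rw [LinearIndependent.pair_iff]
    intro s t hst
    have hi := congrFun hst i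
    have hj := congrFun hst j
    simp [realVec, a, b, hij, hij.symm] at hi hj
    exact ⟨hi, hj⟩
  have h3 := finrank_span_eq_card hli
  rw [Matrix.range_cons, Matrix.range_cons, Matrix.range_empty, Set.union_empty,
    Set.singleton_union, Fintype.card_fin] at h3
  rw [h3]
  have h4 : Submodule.span ℝ ({realVec a, realVec (-a)} : Set (Fin r → ℝ)) ≤
      Submodule.span ℝ {realVec a} := by
    rw [Submodule.span_le]
    rintro _ (rfl | rfl)
    · exact Submodule.subset_span rfl
    · rw [realVec_neg]
      exact Submodule.neg_mem _ (Submodule.subset_span rfl)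
  have h5 := finrank_span_le_card (R := ℝ) ({realVec a} : Set (Fin r → ℝ))
  rw [Set.toFinset_singleton, Finset.card_singleton] at h5
  exact lt_of_le_of_lt (Submodule.finrank_mono h4) (by omega)

end TwoRays

/-! ### The rank of the orthogonal lattice -/

/-- The rank of the subgroup generated by a set of integer vectors is the dimension of its real
span. -/
theorem finrank_span_int_eq_finrank_span_real {ι : Type*} [Finite ι] (S : Set (ι → ℤ)) :
    Module.finrank ℤ (Submodule.span ℤ S) =
      Module.finrank ℝ (Submodule.span ℝ ((fun v i => (v i : ℝ)) '' S)) := by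
  have := Fintype.ofFinite ι
  refine le_antisymm ?_ ?_
  · let b := Module.finBasis ℤ (Submodule.span ℤ S)
    have h1 : LinearIndependent ℤ fun i => (b i : ι → ℤ) :=
      b.linearIndependent.map' (Submodule.span ℤ S).subtype (Submodule.ker_subtype _)
    have h2 := linearIndependent_algebraMap_comp_iff (S := ℝ) |>.2 h1
    have h3 : ∀ i, algebraMap ℤ ℝ ∘ (b i : ι → ℤ) ∈
        Submodule.span ℝ ((fun v i => (v i : ℝ)) '' S) := by
      intro i
      have : ∀ x ∈ Submodule.span ℤ S, algebraMap ℤ ℝ ∘ x ∈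
          Submodule.span ℝ ((fun (v : ι → ℤ) i => (v i : ℝ)) '' S) := by
        intro x hx
        induction hx using Submodule.span_induction with
        | mem x hx => exact Submodule.subset_span ⟨x, hx, rfl⟩
        | zero =>
          convert Submodule.zero_mem _
          ext; simp
        | add x y _ _ hx hy =>
          convert Submodule.add_mem _ hx hy using 1
          ext; simp
        | smul a x _ hx =>
          convert Submodule.smul_mem _ (a : ℝ) hx using 1
          ext; simp
      exact this _ (b i).2
    have h4 : LinearIndependent ℝ (fun i => (⟨_, h3 i⟩ :
        Submodule.span ℝ ((fun (v : ι → ℤ) i => (v i : ℝ)) '' S))) :=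
      LinearIndependent.of_comp (Submodule.subtype _) h2
    simpa using h4.fintype_card_le_finrank
  · obtain ⟨b, hbS, hspan, hli⟩ :=
      exists_linearIndependent ℝ ((fun (v : ι → ℤ) i => (v i : ℝ)) '' S)
    have : Fintype b := @Fintype.ofFinite _ hli.finite
    rw [← hspan, finrank_span_set_eq_card hli, Set.toFinset_card]
    choose f hfS hf using hbS
    have h1 : LinearIndependent ℤ fun i : b => f i.2 := by
      rw [← linearIndependent_algebraMap_comp_iff (S := ℝ)]
      have e : (fun i : b => algebraMap ℤ ℝ ∘ f i.2) = Subtype.val := funext fun i => hf i.2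
      rw [e]
      exact hli
    have h4 : LinearIndependent ℤ (fun i : b => (⟨_, Submodule.subset_span (hfS i.2)⟩ :
        Submodule.span ℤ S)) :=
      LinearIndependent.of_comp (Submodule.subtype _) h1
    exact h4.fintype_card_le_finrank

variable (Δ : ToricFan r)

/-- The lattice `|Δ|^⊥ ∩ M` is the kernel of the matrix whose rows generate the cones of `Δ`. -/
theorem finrank_orthogonalLattice_add_spanDim :
    Module.finrank ℤ Δ.orthogonalLattice + Δ.spanDim = r := by
  classical
  choose V hV using Δ.rational
  have := Δ.finite.to_subtype
  have := Fintype.ofFinite Δ.cones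
  let W : Finset (Fin r → ℤ) := Finset.univ.biUnion fun σ : Δ.cones => V σ.1 σ.2
  have hspan : Submodule.span ℝ Δ.support = Submodule.span ℝ (realVec '' (W : Set (Fin r → ℤ))) := by
    refine le_antisymm (Submodule.span_le.2 fun x hx => ?_) (Submodule.span_mono ?_)
    · obtain ⟨σ, hσ, hx⟩ := Set.mem_iUnion₂.1 hx
      have h1 : x ∈ Submodule.span ℝ (σ : Set (Fin r → ℝ)) := Submodule.subset_span hx
      rw [hV σ hσ, span_hull] at h1
      refine Submodule.span_mono (Set.image_mono fun v hv => ?_) h1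
      exact Finset.mem_coe.2 (Finset.mem_biUnion.2 ⟨⟨σ, hσ⟩, Finset.mem_univ _, hv⟩)
    · rintro _ ⟨v, hv, rfl⟩
      obtain ⟨⟨σ, hσ⟩, -, hv⟩ := Finset.mem_biUnion.1 (Finset.mem_coe.1 hv)
      refine Set.mem_iUnion₂.2 ⟨σ, hσ, ?_⟩
      rw [hV σ hσ]
      exact realVec_mem hv
  let A : Matrix W (Fin r) ℤ := Matrix.of fun v => v.1
  have hker : LinearMap.ker A.mulVecLin = Δ.orthogonalLattice := by
    ext m
    rw [LinearMap.mem_ker, mem_orthogonalLattice]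
    have hA : ∀ v : W, ((A.mulVecLin m v : ℤ) : ℝ) = pairing m (realVec v.1) := fun v => by
      rw [pairing_intCast, Matrix.mulVecLin_apply, Matrix.mulVec, dotProduct]
      exact congrArg _ (Finset.sum_congr rfl fun i _ => mul_comm _ _)
    constructor
    · intro h σ hσ x hx
      refine pairing_eq_zero_of_mem_span (s := realVec '' (W : Set (Fin r → ℤ))) ?_ ?_
      · rintro _ ⟨v, hv, rfl⟩
        rw [← hA ⟨v, hv⟩, h]
        simp
      · rw [← hspan]
        exact Submodule.subset_span (Set.mem_iUnion₂.2 ⟨σ, hσ, hx⟩)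
    · intro h
      ext v
      obtain ⟨⟨σ, hσ⟩, -, hv⟩ := Finset.mem_biUnion.1 v.2
      have h1 := h σ hσ (realVec v.1) (by rw [hV σ hσ]; exact realVec_mem hv)
      rw [← hA] at h1
      exact_mod_cast h1
  have hrange : Module.finrank ℤ (LinearMap.range A.mulVecLin) = Δ.spanDim := by
    rw [Matrix.range_mulVecLin, finrank_span_int_eq_finrank_span_real, spanDim, hspan]
    have e1 : ((fun (v : W → ℤ) i => (v i : ℝ)) '' Set.range A.col) =
        Set.range (A.map ((↑) : ℤ → ℝ)).col := by
      rw [← Set.range_comp]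
      rfl
    have e2 : realVec '' (W : Set (Fin r → ℤ)) = Set.range (A.map ((↑) : ℤ → ℝ)).row := by
      rw [Set.image_eq_range]
      rfl
    rw [e1, e2, ← Matrix.rank_eq_finrank_span_cols, Matrix.rank_eq_finrank_span_row]
  have h := Submodule.finrank_quotient_add_finrank (LinearMap.ker A.mulVecLin)
  rw [A.mulVecLin.quotKerEquivRange.finrank_eq, hker, hrange, Module.finrank_fin_fun] at h
  omega

end ToricFan

/-! ### The ring of the torus -/

/-- A unit of the monoid algebra of a monoid with two unique sums (for example a torsion-free
abelian group) is a monomial. -/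
theorem AddMonoidAlgebra.exists_eq_single_of_isUnit {k A : Type*} [Field k] [AddMonoid A]
    [TwoUniqueSums A] {f : AddMonoidAlgebra k A} (hf : IsUnit f) :
    ∃ a c, c ≠ 0 ∧ f = AddMonoidAlgebra.single a c := by
  classical
  obtain ⟨g, hfg⟩ := hf.exists_right_inv
  have hcoeff : ∀ a, (f * g).coeff a ≠ 0 → a = 0 := fun a ha => by
    by_contra h
    rw [hfg, AddMonoidAlgebra.one_def, AddMonoidAlgebra.coeff_single,
      Finsupp.single_apply, if_neg (Ne.symm h)] at ha
    exact ha rfl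
  have hcard : f.coeff.support.card * g.coeff.support.card ≤ 1 := by
    by_contra! hlt
    obtain ⟨p, hp, q, hq, hne, hup, huq⟩ := TwoUniqueSums.uniqueAdd_of_one_lt_card hlt
    rw [Finset.mem_product] at hp hq
    have h1 := hcoeff (p.1 + p.2) (by
      rw [AddMonoidAlgebra.coeff_mul_add_of_uniqueAdd hup]
      exact mul_ne_zero (Finsupp.mem_support_iff.1 hp.1) (Finsupp.mem_support_iff.1 hp.2))
    have h2 := hcoeff (q.1 + q.2) (by
      rw [AddMonoidAlgebra.coeff_mul_add_of_uniqueAdd huq]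
      exact mul_ne_zero (Finsupp.mem_support_iff.1 hq.1) (Finsupp.mem_support_iff.1 hq.2))
    obtain ⟨h3, h4⟩ := hup hq.1 hq.2 (h2.trans h1.symm)
    exact hne (Prod.ext h3.symm h4.symm)
  have hg0 : g ≠ 0 := by
    rintro rfl
    rw [mul_zero] at hfg
    have := congrArg (fun h => AddMonoidAlgebra.coeff h 0) hfg
    simp [AddMonoidAlgebra.one_def] at this
  have hf0 : f ≠ 0 := by
    rintro rfl
    rw [zero_mul] at hfg
    have := congrArg (fun h => AddMonoidAlgebra.coeff h 0) hfg
    simp [AddMonoidAlgebra.one_def] at this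
  have hfc : 0 < f.coeff.support.card := by
    rw [Finset.card_pos, Finsupp.support_nonempty_iff]
    exact fun h => hf0 (AddMonoidAlgebra.coeff_eq_zero.1 h)
  have hgc : 0 < g.coeff.support.card := by
    rw [Finset.card_pos, Finsupp.support_nonempty_iff]
    exact fun h => hg0 (AddMonoidAlgebra.coeff_eq_zero.1 h)
  have h1 : f.coeff.support.card = 1 := by nlinarith
  obtain ⟨a, hc, hfa⟩ := Finsupp.card_support_eq_one.1 h1
  exact ⟨a, f.coeff a, hc, AddMonoidAlgebra.coeff_inj.1 hfa⟩

namespace ToricFan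

variable {r : ℕ} (k : Type u) [Field k]

/-- The positive orthant. -/
def orthant (r : ℕ) : PointedCone ℝ (Fin r → ℝ) :=
  PointedCone.hull ℝ (realVec '' ((Finset.univ.image fun i => Pi.single i 1 :
    Finset (Fin r → ℤ)) : Set (Fin r → ℤ)))

theorem isRational_orthant : IsRational (orthant r) := ⟨_, rfl⟩

theorem mem_dualMonoid_orthant {m : Fin r → ℤ} : m ∈ dualMonoid (orthant r) ↔ ∀ i, 0 ≤ m i := by
  refine mem_dualMonoid_hull.trans ?_
  simp [Pi.single_apply]

theorem stronglyConvex_orthant : ∀ x ∈ orthant r, -x ∈ orthant r → x = 0 := by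
  intro x hx hx'
  ext i
  have hi : (Pi.single i 1 : Fin r → ℤ) ∈ dualMonoid (orthant r) :=
    mem_dualMonoid_orthant.2 fun j => by
      rw [Pi.single_apply]; split_ifs <;> simp
  have h1 := hi x hx
  have h2 := hi _ hx'
  have e : ∀ y : Fin r → ℝ, pairing (Pi.single i 1) y = y i := fun y => by
    simp [pairing, Pi.single_apply]
  rw [e] at h1 h2
  rw [Pi.neg_apply] at h2
  rw [Pi.zero_apply]
  linarith

/-- The lattice points dual to the positive orthant are the exponents of monomials. -/
noncomputable def dualMonoidOrthantEquiv : (Fin r →₀ ℕ) ≃+ dualMonoid (orthant r) where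
  toFun a := ⟨fun i => a i, mem_dualMonoid_orthant.2 fun i => by positivity⟩
  invFun m := Finsupp.equivFunOnFinite.symm fun i => (m.1 i).toNat
  left_inv a := by ext i; simp
  right_inv m := by
    ext i
    simpa using mem_dualMonoid_orthant.1 m.2 i
  map_add' a b := by ext i; simp

instance uniqueFactorizationMonoid_coordRing_orthant :
    UniqueFactorizationMonoid (coordRing k (orthant r)) := by
  have e : MvPolynomial (Fin r) k ≃ₐ[k] coordRing k (orthant r) :=
    AddMonoidAlgebra.domCongr k k dualMonoidOrthantEquiv
  exact e.toMulEquiv.uniqueFactorizationMonoid inferInstance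

/-- The ring `k[M]` of the torus, as a localization of a polynomial ring, is factorial. -/
instance uniqueFactorizationMonoid_coordRing_bot :
    UniqueFactorizationMonoid (coordRing k (⊥ : PointedCone ℝ (Fin r → ℝ))) := by
  obtain ⟨m, hm, h⟩ := isFace_bot (isRational_orthant (r := r)) stronglyConvex_orthant
  let := (coordMap k (bot_le : ⊥ ≤ orthant r)).toAlgebra
  have := isLocalization_coordMap k isRational_orthant bot_le ⟨m, hm⟩ h
  exact UniqueFactorizationMonoid.of_isLocalization
    (Submonoid.powers (AddMonoidAlgebra.single (⟨m, hm⟩ : dualMonoid (orthant r)) (1 : k) :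
      coordRing k (orthant r))) _

theorem mem_dualMonoid_bot (m : Fin r → ℤ) :
    m ∈ dualMonoid (⊥ : PointedCone ℝ (Fin r → ℝ)) := fun x hx => by
  rw [(Submodule.mem_bot _).1 hx, pairing_zero_right]

end ToricFan

/-! ### Affine charts of an integral scheme -/

/-- Being a localization, for ring homomorphisms `f` and `g` that differ by an isomorphism of their
targets. -/
theorem isLocalization_of_ringEquiv_comp {R S P : Type*} [CommRing R] [CommRing S] [CommRing P]
    (M : Submonoid R) (f : R →+* S) (g : R →+* P) (e : S ≃+* P) (h : ∀ a, e (f a) = g a)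
    (hg : letI := g.toAlgebra; IsLocalization M P) :
    letI := f.toAlgebra
    IsLocalization M S := by
  let := f.toAlgebra
  let := g.toAlgebra
  exact IsLocalization.isLocalization_of_algEquiv M
    (AlgEquiv.ofRingEquiv (f := e.symm) fun a => by
      rw [RingEquiv.symm_apply_eq]
      exact (h a).symm)

namespace AlgebraicGeometry

section AffineChart

variable {X : Scheme.{u}} {A B : CommRingCat.{u}} (j : Spec A ⟶ X) [IsOpenImmersion j]

/-- For an affine chart `j : Spec A ⟶ X`, the identification of `A` with the sections of `X` over
the image of `j`. -/
noncomputable def chartSection : A ⟶ Γ(X, j ''ᵁ ⊤) := (Scheme.ΓSpecIso A).inv ≫ (j.appIso ⊤).inv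

theorem chartSection_appLE : chartSection j ≫ j.appLE (j ''ᵁ ⊤) ⊤ (j.preimage_image_eq ⊤).ge =
    (Scheme.ΓSpecIso A).inv := by
  rw [chartSection, Category.assoc, ← Scheme.Hom.appIso_hom', Iso.inv_hom_id, Category.comp_id]

theorem chartSection_eq_iff {a : A} {s : Γ(X, j ''ᵁ ⊤)} :
    chartSection j a = s ↔
      (Scheme.ΓSpecIso A).inv a = j.appLE (j ''ᵁ ⊤) ⊤ (j.preimage_image_eq ⊤).ge s := by
  rw [← chartSection_appLE j, CommRingCat.comp_apply]
  refine ⟨fun h => by rw [h], fun h => ?_⟩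
  have hinj : Function.Injective (j.appLE (j ''ᵁ ⊤) ⊤ (j.preimage_image_eq ⊤).ge) := by
    rw [← Scheme.Hom.appIso_hom']
    exact (ConcreteCategory.bijective_of_isIso (j.appIso ⊤).hom).1
  exact hinj h

instance : IsIso (chartSection j) := by
  unfold chartSection
  infer_instance

theorem mem_chart (y : Spec A) : j y ∈ j ''ᵁ ⊤ := ⟨y, trivial, rfl⟩

/-- The map from `A` to the local ring of `X` at a point of the chart `Spec A ⟶ X`. -/
noncomputable def chartToStalk (y : Spec A) : A →+* X.presheaf.stalk (j y) :=
  (chartSection j ≫ X.presheaf.germ (j ''ᵁ ⊤) (j y) (mem_chart j y)).hom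

theorem stalkMap_chartToStalk (y : Spec A) (a : A) :
    j.stalkMap y (chartToStalk j y a) = StructureSheaf.toStalk A y a := by
  change j.stalkMap y (X.presheaf.germ (j ''ᵁ ⊤) (j y) (mem_chart j y) (chartSection j a)) = _
  rw [Scheme.Hom.germ_stalkMap_apply]
  have h := (chartSection_eq_iff j (a := a)).1 rfl
  have h1 : (Spec A).presheaf.germ ⊤ y trivial ((Scheme.ΓSpecIso A).inv a) =
      StructureSheaf.toStalk A y a := rfl
  rw [← h1, h, Scheme.Hom.appLE, CommRingCat.comp_apply]
  exact ((Spec A).presheaf.germ_res_apply _ _ _ _).symm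

theorem isLocalization_chartToStalk (y : PrimeSpectrum A) :
    letI := (chartToStalk j y).toAlgebra
    IsLocalization.AtPrime (X.presheaf.stalk (j y)) y.asIdeal := by
  have : IsIso (j.stalkMap y) := inferInstanceAs (IsIso (j.stalkMap (show Spec A from y)))
  exact isLocalization_of_ringEquiv_comp y.asIdeal.primeCompl (chartToStalk j y)
    (StructureSheaf.toStalk A y).hom (asIso (j.stalkMap y)).commRingCatIsoToRingEquiv
    (stalkMap_chartToStalk j y) (StructureSheaf.IsLocalization.to_stalk A y)

theorem coheight_chart (y : PrimeSpectrum A) :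
    Order.coheight (j y) = y.asIdeal.height :=
  (coheight_eq_of_isOpenImmersion (x := y) j).trans (idealHeight_eq_coheight A y).symm

variable [IsIntegral X] [Nonempty (Spec A)]

instance nonempty_chart : Nonempty (j ''ᵁ ⊤ : X.Opens) :=
  ⟨⟨j (Classical.arbitrary (Spec A)), mem_chart j _⟩⟩

/-- The map from `A` to the function field of `X`, for an affine chart `Spec A ⟶ X`. -/
noncomputable def chartToFunctionField : A →+* X.functionField :=
  (chartSection j ≫ X.germToFunctionField (j ''ᵁ ⊤)).hom

theorem algebraMap_chartToStalk (y : PrimeSpectrum A) (a : A) :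
    algebraMap (X.presheaf.stalk (j y)) X.functionField (chartToStalk j y a) =
      chartToFunctionField j a :=
  Scheme.algebraMap_germ_eq_germToFunctionField X (mem_chart j y) (chartSection j a)

theorem chartToFunctionField_injective : Function.Injective (chartToFunctionField j) :=
  (Scheme.germToFunctionField_injective X (j ''ᵁ ⊤)).comp
    (ConcreteCategory.bijective_of_isIso (chartSection j)).1

theorem isFractionRing_chartToFunctionField :
    letI := (chartToFunctionField j).toAlgebra
    IsFractionRing A X.functionField := by
  let := (chartToFunctionField j).toAlgebra
  have h := functionField_isFractionRing_of_isAffineOpen X (j ''ᵁ ⊤)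
    ((isAffineOpen_top (Spec A)).image_of_isOpenImmersion j)
  rw [IsFractionRing.isFractionRing_iff_of_base_ringEquiv X.functionField
    (asIso (chartSection j)).commRingCatIsoToRingEquiv]
  refine (congrArg (fun i : Algebra Γ(X, j ''ᵁ ⊤) X.functionField =>
    @IsFractionRing Γ(X, j ''ᵁ ⊤) _ X.functionField _ i)
    (Algebra.algebra_ext _ _ fun s => ?_)).mpr h
  change X.germToFunctionField _ ((chartSection j) (inv (chartSection j) s)) = _
  rw [← CommRingCat.comp_apply (inv (chartSection j)), IsIso.inv_hom_id]
  rfl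

/-- The maps to the function field are compatible with the inclusion of a smaller chart. -/
theorem chartToFunctionField_map [Nonempty (Spec B)] (φ : A ⟶ B)
    (j' : Spec B ⟶ X) [IsOpenImmersion j'] (h : Spec.map φ ≫ j = j') (a : A) :
    chartToFunctionField j' (φ a) = chartToFunctionField j a := by
  have hle : j' ''ᵁ ⊤ ≤ j ''ᵁ ⊤ := by
    rintro _ ⟨y, -, rfl⟩
    rw [← h]
    exact ⟨_, trivial, rfl⟩
  have : chartSection j' (φ a) = X.presheaf.map (homOfLE hle).op (chartSection j a) := by
    rw [chartSection_eq_iff, ← CommRingCat.comp_apply (X.presheaf.map _), Scheme.Hom.map_appLE]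
    subst h
    rw [← Scheme.Hom.appLE_comp_appLE (Spec.map φ) j (j ''ᵁ ⊤) ⊤ ⊤ (j.preimage_image_eq ⊤).ge le_top,
      CommRingCat.comp_apply, ← (chartSection_eq_iff j (a := a)).1 rfl,
      ← CommRingCat.comp_apply, ← CommRingCat.comp_apply, Scheme.ΓSpecIso_inv_naturality]
    rfl
  change X.germToFunctionField _ (chartSection j' (φ a)) = X.germToFunctionField _ _
  rw [this]
  exact X.presheaf.germ_res_apply _ _ _ _

/-- A global section, restricted to a chart, has the same image in the function field. -/
theorem chartToFunctionField_appTop [Nonempty (⊤ : X.Opens)] (s : Γ(X, ⊤)) :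
    chartToFunctionField j ((Scheme.ΓSpecIso A).hom (j.appTop s)) = X.germToFunctionField ⊤ s := by
  have : chartSection j ((Scheme.ΓSpecIso A).hom (j.appTop s)) =
      X.presheaf.map (homOfLE le_top).op s := by
    rw [chartSection_eq_iff, ← CommRingCat.comp_apply, Iso.hom_inv_id,
      ← CommRingCat.comp_apply (X.presheaf.map _), Scheme.Hom.map_appLE]
    change _ = j.appLE ⊤ (j ⁻¹ᵁ ⊤) le_rfl s
    rw [Scheme.Hom.appLE_eq_app]
    rfl
  change X.germToFunctionField _ (chartSection j _) = _
  rw [this]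
  exact X.presheaf.germ_res_apply _ _ _ _

variable [IsLocallyNoetherian X]

/-- The order of a function on a chart can be computed in the local ring; `n : ℕ` says that it is
finite there. -/
theorem ord_chart (y : PrimeSpectrum A) (hy : y.asIdeal.height = 1) {a : A} (ha : a ≠ 0) {n : ℕ}
    (hn : Ring.ord (X.presheaf.stalk (j y)) (chartToStalk j y a) = n) :
    Scheme.ord (chartToFunctionField j a) (j y) = n := by
  have hz : Order.coheight (j y) = 1 := (coheight_chart j y).trans hy
  have hK : chartToFunctionField j a ≠ 0 :=
    (map_ne_zero_iff _ (chartToFunctionField_injective j)).2 ha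
  have : Ring.KrullDimLE 1 (X.presheaf.stalk (j y)) := krullDimLE_of_coheight_le hz.le
  have h0 : chartToStalk j y a ≠ 0 := fun h => hK (by
    rw [← algebraMap_chartToStalk j y, h, map_zero])
  rw [Scheme.ord_eq_iff hz hK]
  change Ring.ordFrac (X.presheaf.stalk (j y)) _ = _
  rw [← algebraMap_chartToStalk j y, Ring.ordFrac_eq_ord _ h0,
    Ring.ordMonoidWithZeroHom_eq_coe _ (mem_nonZeroDivisors_of_ne_zero h0) hn]

theorem ord_chart_of_notMem (y : PrimeSpectrum A) (hy : y.asIdeal.height = 1) {a : A}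
    (ha : a ∉ y.asIdeal) : Scheme.ord (chartToFunctionField j a) (j y) = 0 := by
  let := (chartToStalk j y).toAlgebra
  have := isLocalization_chartToStalk j y
  refine ord_chart j y hy (n := 0) (fun h => ha (by rw [h]; exact y.asIdeal.zero_mem)) ?_
  exact Ring.ord_of_isUnit
    ((IsLocalization.AtPrime.isUnit_to_map_iff (X.presheaf.stalk (j y)) y.asIdeal a).2 ha)

theorem ord_chart_pos_of_mem (y : PrimeSpectrum A) (hy : y.asIdeal.height = 1) {a : A}
    (ha0 : a ≠ 0) (ha : a ∈ y.asIdeal) :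
    0 < Scheme.ord (chartToFunctionField j a) (j y) := by
  let := (chartToStalk j y).toAlgebra
  have := isLocalization_chartToStalk j y
  have hz : Order.coheight (j y) = 1 := (coheight_chart j y).trans hy
  have : Ring.KrullDimLE 1 (X.presheaf.stalk (j y)) := krullDimLE_of_coheight_le hz.le
  have h0 : chartToStalk j y a ≠ 0 := fun h => ha0 (chartToFunctionField_injective j (by
    rw [← algebraMap_chartToStalk j y, h, map_zero, map_zero]))
  obtain ⟨n, hn⟩ := ENat.ne_top_iff_exists.1
    (Ring.ord_ne_top (mem_nonZeroDivisors_of_ne_zero h0))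
  rw [ord_chart j y hy ha0 hn.symm]
  have hunit : ¬ IsUnit (chartToStalk j y a) := fun h =>
    (IsLocalization.AtPrime.isUnit_to_map_iff (X.presheaf.stalk (j y)) y.asIdeal a).1 h ha
  refine Nat.cast_pos.2 (Nat.pos_of_ne_zero ?_)
  rintro rfl
  have h1 : Module.length (X.presheaf.stalk (j y))
    (X.presheaf.stalk (j y) ⧸ Ideal.span {chartToStalk j y a}) = 0 := hn.symm
  rw [Module.length_eq_zero_iff, Ideal.Quotient.subsingleton_iff, Ideal.span_singleton_eq_top] at h1
  exact hunit h1

theorem ord_chart_of_eq_span (y : PrimeSpectrum A) (hy : y.asIdeal.height = 1) {a : A}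
    (ha0 : a ≠ 0) (ha : y.asIdeal = Ideal.span {a}) :
    Scheme.ord (chartToFunctionField j a) (j y) = 1 := by
  let := (chartToStalk j y).toAlgebra
  have := isLocalization_chartToStalk j y
  refine ord_chart j y hy (n := 1) ha0 ?_
  have h1 := IsLocalization.AtPrime.map_eq_maximalIdeal y.asIdeal (X.presheaf.stalk (j y))
  have h2 : Ideal.span {chartToStalk j y a} =
      IsLocalRing.maximalIdeal (X.presheaf.stalk (j y)) := by
    rw [← h1]
    conv_rhs => rw [ha, Ideal.map_span, Set.image_singleton]
    rfl
  rw [Ring.ord, h2, Nat.cast_one, Module.length_eq_one_iff, isSimpleModule_iff_isCoatom]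
  exact Ideal.isMaximal_def.1 inferInstance

end AffineChart

end AlgebraicGeometry

namespace ToricFan

variable {r : ℕ} (Δ : ToricFan r) (k : Type u) [Field k]

/-! ### The charts of a toric variety -/

section Charts

/-- The inclusion of the chart `U_σ` in the toric variety. -/
noncomputable def chartι (σ : Δ.Cone) :
    Spec (CommRingCat.of (coordRing k σ.1)) ⟶ Δ.variety k :=
  colimit.ι (Δ.diagram k) σ

instance (σ : Δ.Cone) : IsOpenImmersion (Δ.chartι k σ) :=
  inferInstanceAs (IsOpenImmersion (colimit.ι (Δ.diagram k) σ))

instance (σ : PointedCone ℝ (Fin r → ℝ)) : Nonempty (Spec (CommRingCat.of (coordRing k σ))) :=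
  inferInstanceAs (Nonempty (PrimeSpectrum (coordRing k σ)))

instance nonempty_top_variety : Nonempty (⊤ : (Δ.variety k).Opens) :=
  ⟨⟨genericPoint (Δ.variety k), trivial⟩⟩

variable {Δ}

theorem chartMap_chartι {τ σ : Δ.Cone} (h : τ ≤ σ) :
    chartMap k (show τ.1 ≤ σ.1 from h) ≫ Δ.chartι k σ = Δ.chartι k τ :=
  colimit.w (Δ.diagram k) (homOfLE h)

variable (Δ) in
theorem exists_chartι_eq (x : Δ.variety k) : ∃ σ y, Δ.chartι k σ y = x :=
  Scheme.IsLocallyDirected.ι_jointly_surjective (Δ.diagram k) x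

theorem chartι_eq_iff {σ τ : Δ.Cone} {x : Spec (CommRingCat.of (coordRing k σ.1))}
    {y : Spec (CommRingCat.of (coordRing k τ.1))} :
    Δ.chartι k σ x = Δ.chartι k τ y ↔ ∃ (κ : Δ.Cone) (hσ : κ.1 ≤ σ.1) (hτ : κ.1 ≤ τ.1)
      (z : Spec (CommRingCat.of (coordRing k κ.1))), chartMap k hσ z = x ∧ chartMap k hτ z = y := by
  refine (Scheme.IsLocallyDirected.ι_eq_ι_iff (F := Δ.diagram k) (i := σ) (j := τ)).trans
    ⟨?_, ?_⟩
  · rintro ⟨κ, f, g, z, h1, h2⟩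
    exact ⟨κ, leOfHom f, leOfHom g, z, h1, h2⟩
  · rintro ⟨κ, hσ, hτ, z, h1, h2⟩
    exact ⟨κ, homOfLE hσ, homOfLE hτ, z, h1, h2⟩

variable (Δ) in
/-- The inclusion of the coordinate ring of a chart in the function field of the toric variety. -/
noncomputable def toFunctionField (σ : Δ.Cone) :
    coordRing k σ.1 →+* (Δ.variety k).functionField :=
  chartToFunctionField (Δ.chartι k σ)

theorem toFunctionField_injective (σ : Δ.Cone) : Function.Injective (Δ.toFunctionField k σ) :=
  chartToFunctionField_injective (Δ.chartι k σ)

theorem toFunctionField_coordMap {τ σ : Δ.Cone} (h : τ.1 ≤ σ.1) (a : coordRing k σ.1) :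
    Δ.toFunctionField k τ (coordMap k h a) = Δ.toFunctionField k σ a :=
  chartToFunctionField_map (Δ.chartι k σ) (CommRingCat.ofHom (coordMap k h)) (Δ.chartι k τ)
    (chartMap_chartι k h) a

variable (Δ) in
/-- The restriction of a global function to a chart. -/
noncomputable def restrict (σ : Δ.Cone) : Γ(Δ.variety k, ⊤) →+* coordRing k σ.1 :=
  ((Δ.chartι k σ).appTop ≫ (Scheme.ΓSpecIso (CommRingCat.of (coordRing k σ.1))).hom).hom

theorem toFunctionField_restrict (σ : Δ.Cone) (s : Γ(Δ.variety k, ⊤)) :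
    Δ.toFunctionField k σ (Δ.restrict k σ s) = (Δ.variety k).germToFunctionField ⊤ s :=
  chartToFunctionField_appTop (Δ.chartι k σ) s

theorem restrict_injective (σ : Δ.Cone) : Function.Injective (Δ.restrict k σ) := fun s t h =>
  Scheme.germToFunctionField_injective (Δ.variety k) ⊤ (by
    rw [← toFunctionField_restrict k σ, h, toFunctionField_restrict])

theorem coordMap_restrict {τ σ : Δ.Cone} (h : τ.1 ≤ σ.1) (s : Γ(Δ.variety k, ⊤)) :
    coordMap k h (Δ.restrict k σ s) = Δ.restrict k τ s :=
  toFunctionField_injective k τ (by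
    rw [toFunctionField_coordMap, toFunctionField_restrict, toFunctionField_restrict])

/-- A compatible family of ring homomorphisms to the coordinate rings of the charts lifts to the
ring of global functions. -/
theorem exists_lift_restrict {R : Type u} [CommRing R] (f : ∀ σ : Δ.Cone, R →+* coordRing k σ.1)
    (hf : ∀ (τ σ : Δ.Cone) (h : τ.1 ≤ σ.1), (coordMap k h).comp (f σ) = f τ) :
    ∃ g : R →+* Γ(Δ.variety k, ⊤), ∀ σ, (Δ.restrict k σ).comp g = f σ := by
  let q : Δ.variety k ⟶ Spec (CommRingCat.of R) := colimit.desc (Δ.diagram k)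
    { pt := Spec (CommRingCat.of R)
      ι :=
        { app := fun σ => Spec.map (CommRingCat.ofHom (f σ))
          naturality := fun τ σ h => by
            change Spec.map _ ≫ Spec.map _ = Spec.map _ ≫ 𝟙 _
            rw [Category.comp_id, ← Spec.map_comp, ← CommRingCat.ofHom_comp, hf τ σ] } }
  have hq : ∀ σ, Δ.chartι k σ ≫ q = Spec.map (CommRingCat.ofHom (f σ)) := fun σ =>
    colimit.ι_desc _ σ
  refine ⟨((Scheme.ΓSpecIso (CommRingCat.of R)).inv ≫ q.appTop).hom, fun σ => ?_⟩
  have h : (Scheme.ΓSpecIso (CommRingCat.of R)).inv ≫ q.appTop ≫ (Δ.chartι k σ).appTop ≫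
      (Scheme.ΓSpecIso (CommRingCat.of (coordRing k σ.1))).hom = CommRingCat.ofHom (f σ) := by
    rw [← Scheme.Hom.comp_appTop_assoc, hq, ← Category.assoc, ← Scheme.ΓSpecIso_inv_naturality,
      Category.assoc, Iso.inv_hom_id, Category.comp_id]
  refine RingHom.ext fun a => ?_
  exact congrArg (fun φ => φ.hom a) h

theorem restrict_structureMap (σ : Δ.Cone) (c : k) :
    Δ.restrict k σ (((Scheme.ΓSpecIso (CommRingCat.of k)).inv ≫
      (Δ.structureMap k).appTop).hom c) = algebraMap k (coordRing k σ.1) c := by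
  have hq : Δ.chartι k σ ≫ Δ.structureMap k =
      Spec.map (CommRingCat.ofHom (algebraMap k (coordRing k σ.1))) := colimit.ι_desc _ σ
  have h : (Scheme.ΓSpecIso (CommRingCat.of k)).inv ≫ (Δ.structureMap k).appTop ≫
      (Δ.chartι k σ).appTop ≫ (Scheme.ΓSpecIso (CommRingCat.of (coordRing k σ.1))).hom =
      CommRingCat.ofHom (algebraMap k (coordRing k σ.1)) := by
    rw [← Scheme.Hom.comp_appTop_assoc, hq, ← Category.assoc, ← Scheme.ΓSpecIso_inv_naturality,
      Category.assoc, Iso.inv_hom_id, Category.comp_id]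
  exact congrArg (fun φ => φ.hom c) h

end Charts

/-! ### The units of a toric variety -/

section Units

variable {Δ}

theorem orthogonalLattice_le_dualMonoid (σ : Δ.Cone) :
    Δ.orthogonalLattice.toAddSubmonoid ≤ dualMonoid σ.1 :=
  fun _ hm x hx => (hm σ.1 σ.2 x hx).ge

variable (Δ) in
/-- The characters in `|Δ|^⊥ ∩ M` extend to functions on the whole toric variety. -/
theorem exists_characters : ∃ g : AddMonoidAlgebra k Δ.orthogonalLattice →+* Γ(Δ.variety k, ⊤),
    ∀ (σ : Δ.Cone) (m : Δ.orthogonalLattice) (c : k),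
      Δ.restrict k σ (g (AddMonoidAlgebra.single m c)) =
        AddMonoidAlgebra.single ⟨m.1, orthogonalLattice_le_dualMonoid σ m.2⟩ c := by
  let f : ∀ σ : Δ.Cone, AddMonoidAlgebra k Δ.orthogonalLattice →+* coordRing k σ.1 := fun σ =>
    AddMonoidAlgebra.mapDomainRingHom k
      (AddSubmonoid.inclusion (orthogonalLattice_le_dualMonoid σ))
  have hf : ∀ (σ : Δ.Cone) (m : Δ.orthogonalLattice) (c : k), f σ (AddMonoidAlgebra.single m c) =
      AddMonoidAlgebra.single ⟨m.1, orthogonalLattice_le_dualMonoid σ m.2⟩ c := fun σ m c => by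
    simp only [f, AddMonoidAlgebra.mapDomainRingHom_apply, AddMonoidAlgebra.mapDomain_single]
    rfl
  obtain ⟨g, hg⟩ := exists_lift_restrict k f (fun τ σ h =>
    (AddMonoidAlgebra.mapDomainRingHom_comp _ _).symm)
  exact ⟨g, fun σ m c => (RingHom.congr_fun (hg σ) _).trans (hf σ m c)⟩

/-- The exponent of a unit of `k[σ^∨ ∩ M]` is orthogonal to `σ`. -/
theorem exists_eq_single_of_isUnit {σ : PointedCone ℝ (Fin r → ℝ)} {a : coordRing k σ}
    (ha : IsUnit a) : ∃ (m : dualMonoid σ) (c : k), c ≠ 0 ∧ a = AddMonoidAlgebra.single m c ∧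
      ∀ x ∈ σ, pairing m.1 x = 0 := by
  obtain ⟨b, hab⟩ := ha.exists_right_inv
  have hb : IsUnit b := IsUnit.of_mul_eq_one a (by rw [mul_comm, hab])
  obtain ⟨m, c, hc, rfl⟩ := AddMonoidAlgebra.exists_eq_single_of_isUnit ha
  obtain ⟨m', c', hc', rfl⟩ := AddMonoidAlgebra.exists_eq_single_of_isUnit hb
  refine ⟨m, c, hc, rfl, fun x hx => ?_⟩
  rw [AddMonoidAlgebra.single_mul_single, AddMonoidAlgebra.one_def] at hab
  have h := congrArg (fun f => AddMonoidAlgebra.coeff f (m + m')) hab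
  simp only [AddMonoidAlgebra.coeff_single, Finsupp.single_eq_same] at h
  have h0 : m + m' = 0 := by
    by_contra hne
    rw [Finsupp.single_apply, if_neg (Ne.symm hne)] at h
    exact mul_ne_zero hc hc' h
  have h1 := m.2 x hx
  have h2 := m'.2 x hx
  have h3 : pairing (m.1 + m'.1) x = 0 := by
    rw [show m.1 + m'.1 = 0 from congrArg Subtype.val h0, pairing_zero_left]
  rw [pairing_add_left] at h3
  linarith

theorem eq_of_single_eq_single {σ : PointedCone ℝ (Fin r → ℝ)} {m m' : dualMonoid σ} {c c' : k}
    (hc : c ≠ 0) (h : (AddMonoidAlgebra.single m c : coordRing k σ) =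
      AddMonoidAlgebra.single m' c') : m' = m := by
  by_contra hne
  have h1 := congrArg (fun f => AddMonoidAlgebra.coeff f m) h
  simp only [AddMonoidAlgebra.coeff_single, Finsupp.single_eq_same] at h1
  rw [Finsupp.single_apply, if_neg hne] at h1
  exact hc h1

theorem eq_of_coordMap_single_eq_single {σ τ : PointedCone ℝ (Fin r → ℝ)} (h : τ ≤ σ)
    {m : dualMonoid σ} {m' : dualMonoid τ} {c c' : k} (hc : c' ≠ 0)
    (he : coordMap k h (AddMonoidAlgebra.single m c) = AddMonoidAlgebra.single m' c') :
    m.1 = m'.1 := by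
  rw [coordMap_single] at he
  exact congrArg Subtype.val (eq_of_single_eq_single k hc he.symm)

theorem eq_zero_of_algebraMap_eq_single {σ : PointedCone ℝ (Fin r → ℝ)} {m : dualMonoid σ}
    {c c' : k} (hc : c' ≠ 0)
    (h : algebraMap k (coordRing k σ) c = AddMonoidAlgebra.single m c') : m.1 = 0 := by
  rw [AddMonoidAlgebra.coe_algebraMap] at h
  exact (congrArg Subtype.val (eq_of_single_eq_single k hc h.symm)).symm

variable (Δ) in
/-- The units of a toric variety modulo constants are the characters in `|Δ|^⊥ ∩ M`. -/
theorem nonempty_addEquiv_H0GmModConst :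
    Nonempty (Δ.orthogonalLattice ≃+ H0GmModConst (Δ.structureMap k)) := by
  obtain ⟨g, hg⟩ := Δ.exists_characters k
  let χ : Multiplicative Δ.orthogonalLattice →* Γ(Δ.variety k, ⊤)ˣ :=
    ((g : AddMonoidAlgebra k Δ.orthogonalLattice →* Γ(Δ.variety k, ⊤)).comp
      (AddMonoidAlgebra.of k Δ.orthogonalLattice)).toHomUnits
  have hχ : ∀ m : Δ.orthogonalLattice, (χ (Multiplicative.ofAdd m) : Γ(Δ.variety k, ⊤)) =
      g (AddMonoidAlgebra.single m 1) := fun m => rfl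
  let χ' : Δ.orthogonalLattice →+ H0Gm (Δ.variety k) :=
    (MonoidHom.toAdditiveRight χ : Δ.orthogonalLattice →+ Additive Γ(Δ.variety k, ⊤)ˣ)
  let φ : Δ.orthogonalLattice →+ H0GmModConst (Δ.structureMap k) :=
    (QuotientAddGroup.mk' (constUnits (Δ.structureMap k)).range).comp χ'
  refine ⟨AddEquiv.ofBijective φ ⟨?_, ?_⟩⟩
  · rw [injective_iff_map_eq_zero]
    intro m hm
    obtain ⟨c, hc⟩ := (QuotientAddGroup.eq_zero_iff _).1 hm
    have h1 : ((Scheme.ΓSpecIso (CommRingCat.of k)).inv ≫ (Δ.structureMap k).appTop).hom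
        (c.toMul : k) = g (AddMonoidAlgebra.single m 1) :=
      congrArg (fun u : Additive Γ(Δ.variety k, ⊤)ˣ => (u.toMul : Γ(Δ.variety k, ⊤))) hc
    have h2 := congrArg (Δ.restrict k Δ.zeroCone) h1
    rw [restrict_structureMap, hg] at h2
    exact Subtype.ext (eq_zero_of_algebraMap_eq_single k one_ne_zero h2)
  · intro q
    obtain ⟨u, rfl⟩ := QuotientAddGroup.mk'_surjective _ q
    let w : Γ(Δ.variety k, ⊤)ˣ := (show Additive Γ(Δ.variety k, ⊤)ˣ from u).toMul
    obtain ⟨m, c, hc, hm, -⟩ := exists_eq_single_of_isUnit k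
      (w.isUnit.map (Δ.restrict k Δ.zeroCone))
    have hmem : m.1 ∈ Δ.orthogonalLattice := by
      intro σ hσ x hx
      obtain ⟨m', c', hc', hm', h0⟩ := exists_eq_single_of_isUnit k
        (w.isUnit.map (Δ.restrict k ⟨σ, hσ⟩))
      have h1 := coordMap_restrict k (zeroCone_le (Δ := Δ) ⟨σ, hσ⟩) (w : Γ(Δ.variety k, ⊤))
      rw [hm, hm'] at h1
      exact (congrArg (pairing · x) (eq_of_coordMap_single_eq_single k _ hc h1)).symm.trans
        (h0 x hx)
    refine ⟨⟨m.1, hmem⟩, ?_⟩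
    refine (QuotientAddGroup.eq (s := (constUnits (Δ.structureMap k)).range)).2
      ⟨Additive.ofMul (Units.mk0 c hc), ?_⟩
    rw [eq_neg_add_iff_add_eq]
    have h4 : g (AddMonoidAlgebra.single ⟨m.1, hmem⟩ 1) *
        ((Scheme.ΓSpecIso (CommRingCat.of k)).inv ≫ (Δ.structureMap k).appTop).hom c = w := by
      refine restrict_injective k Δ.zeroCone ?_
      rw [map_mul, hg, restrict_structureMap, hm, AddMonoidAlgebra.coe_algebraMap,
        Function.comp_apply, AddMonoidAlgebra.single_mul_single, one_mul]
      congr 1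
      exact Subtype.ext (add_zero _)
    exact congrArg Additive.ofMul (Units.ext h4)

theorem finite_and_finrank_rat_tensor {M : Type u} [AddCommGroup M] [Module.Finite ℤ M] :
    Module.Finite ℚ (ℚ ⊗[ℤ] M) ∧ Module.finrank ℚ (ℚ ⊗[ℤ] M) = Module.finrank ℤ M :=
  ⟨inferInstance, (TensorProduct.isBaseChange ℤ M ℚ).finrank_eq⟩

variable (Δ) in
theorem finite_unitsQ_and_rho0_add_spanDim :
    Module.Finite ℚ (Δ.unitsQ k) ∧ Δ.rho0 k + Δ.spanDim = r := by
  obtain ⟨e⟩ := Δ.nonempty_addEquiv_H0GmModConst k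
  have : Module.Finite ℤ (H0GmModConst (Δ.structureMap k)) :=
    Module.Finite.equiv e.toIntLinearEquiv
  obtain ⟨h1, h2⟩ := finite_and_finrank_rat_tensor (M := H0GmModConst (Δ.structureMap k))
  refine ⟨h1, ?_⟩
  rw [rho0, h2, ← e.toIntLinearEquiv.finrank_eq]
  exact Δ.finrank_orthogonalLattice_add_spanDim

end Units

end ToricFan

namespace ToricFan

variable {r : ℕ} (k : Type u) [Field k]

/-! ### Torus invariant prime ideals -/

section FaceIdeal

variable {σ τ : PointedCone ℝ (Fin r → ℝ)}

open Classical in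
/-- For a subcone `τ ⊆ σ`, the endomorphism of `k[σ^∨ ∩ M]` which fixes the characters in `τ^⊥` and
kills the other ones. For a face `τ` it is the restriction of functions to the closure of the torus
orbit of `τ`. -/
noncomputable def orthProj (h : τ ≤ σ) : coordRing k σ →ₐ[k] coordRing k σ :=
  AddMonoidAlgebra.lift k (coordRing k σ) (dualMonoid σ)
    { toFun := fun m =>
        if ∀ x ∈ τ, pairing m.toAdd.1 x = 0 then AddMonoidAlgebra.single m.toAdd 1 else 0
      map_one' := if_pos fun x _ => pairing_zero_left x
      map_mul' := fun m n => by
        have hmn : (∀ x ∈ τ, pairing (m.toAdd.1 + n.toAdd.1) x = 0) ↔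
            (∀ x ∈ τ, pairing m.toAdd.1 x = 0) ∧ ∀ x ∈ τ, pairing n.toAdd.1 x = 0 := by
          rw [← forall₂_and]
          refine forall₂_congr fun x hx => ?_
          rw [pairing_add_left]
          exact add_eq_zero_iff_of_nonneg (m.toAdd.2 x (h hx)) (n.toAdd.2 x (h hx))
        change (if ∀ x ∈ τ, pairing (m.toAdd.1 + n.toAdd.1) x = 0 then
          AddMonoidAlgebra.single (m.toAdd + n.toAdd) 1 else 0) = _
        by_cases h1 : ∀ x ∈ τ, pairing m.toAdd.1 x = 0
        · by_cases h2 : ∀ x ∈ τ, pairing n.toAdd.1 x = 0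
          · rw [if_pos (hmn.2 ⟨h1, h2⟩), if_pos h1, if_pos h2, AddMonoidAlgebra.single_mul_single,
              one_mul]
          · rw [if_neg fun h => h2 (hmn.1 h).2, if_neg h2, mul_zero]
        · rw [if_neg fun h => h1 (hmn.1 h).1, if_neg h1, zero_mul] }

theorem orthProj_single_of_orth (h : τ ≤ σ) {m : dualMonoid σ} (hm : ∀ x ∈ τ, pairing m.1 x = 0)
    (c : k) : orthProj k h (AddMonoidAlgebra.single m c) = AddMonoidAlgebra.single m c := by
  classical
  rw [orthProj, AddMonoidAlgebra.lift_single]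
  refine (congrArg (c • ·) (if_pos hm)).trans ?_
  change c • AddMonoidAlgebra.single m (1 : k) = _
  rw [AddMonoidAlgebra.smul_single, smul_eq_mul, mul_one]

theorem orthProj_single_of_not_orth (h : τ ≤ σ) {m : dualMonoid σ}
    (hm : ¬ ∀ x ∈ τ, pairing m.1 x = 0) (c : k) :
    orthProj k h (AddMonoidAlgebra.single m c) = 0 := by
  classical
  rw [orthProj, AddMonoidAlgebra.lift_single]
  exact (congrArg (c • ·) (if_neg hm)).trans (smul_zero c)

/-- For a face `τ` of `σ`, the prime ideal of `k[σ^∨ ∩ M]` of the generic point of the torus orbit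
of `τ`. It is spanned by the characters which are not in `τ^⊥`. -/
noncomputable def faceIdeal (h : τ ≤ σ) : Ideal (coordRing k σ) := RingHom.ker (orthProj k h)

instance (h : τ ≤ σ) : (faceIdeal k h).IsPrime := RingHom.ker_isPrime _

theorem single_mem_faceIdeal (h : τ ≤ σ) {m : dualMonoid σ} :
    AddMonoidAlgebra.single m (1 : k) ∈ faceIdeal k h ↔ ¬ ∀ x ∈ τ, pairing m.1 x = 0 := by
  rw [faceIdeal, RingHom.mem_ker]
  refine ⟨fun h1 h2 => ?_, fun hm => orthProj_single_of_not_orth k h hm 1⟩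
  rw [orthProj_single_of_orth k h h2] at h1
  exact one_ne_zero (AddMonoidAlgebra.single_eq_zero.1 h1)

/-- The ideal is spanned by the characters it contains: `a` and `orthProj a` differ by an element of
their span. -/
theorem faceIdeal_le (h : τ ≤ σ) {I : Ideal (coordRing k σ)}
    (hI : ∀ m : dualMonoid σ, (¬ ∀ x ∈ τ, pairing m.1 x = 0) →
      AddMonoidAlgebra.single m (1 : k) ∈ I) : faceIdeal k h ≤ I := by
  have key : ∀ a : coordRing k σ, a - orthProj k h a ∈ I := by
    intro a
    induction a using AddMonoidAlgebra.induction_linear with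
    | zero => rw [map_zero, sub_zero]; exact I.zero_mem
    | add f g hf hg =>
      rw [map_add, add_sub_add_comm]
      exact I.add_mem hf hg
    | single m c =>
      by_cases hm : ∀ x ∈ τ, pairing m.1 x = 0
      · rw [orthProj_single_of_orth k h hm, sub_self]
        exact I.zero_mem
      · rw [orthProj_single_of_not_orth k h hm, sub_zero]
        have := I.mul_mem_left (AddMonoidAlgebra.single 0 c) (hI m hm)
        rwa [AddMonoidAlgebra.single_mul_single, zero_add, mul_one] at this
  intro a ha
  have := key a
  rwa [show orthProj k h a = 0 from ha, sub_zero] at this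

theorem single_ne_zero (m : dualMonoid σ) : (AddMonoidAlgebra.single m 1 : coordRing k σ) ≠ 0 :=
  fun h => one_ne_zero (AddMonoidAlgebra.single_eq_zero.1 h)

theorem faceIdeal_ne_bot (hσ : IsRational σ) (hsc : ∀ x ∈ σ, -x ∈ σ → x = 0) (h : τ ≤ σ)
    (hτ : τ ≠ ⊥) : faceIdeal k h ≠ ⊥ := by
  obtain ⟨m, hm⟩ := exists_pairing_pos hσ hsc
  obtain ⟨x, hx, hx0⟩ := Submodule.exists_mem_ne_zero_of_ne_bot hτ
  have hmσ : m ∈ dualMonoid σ := fun y hy => by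
    rcases eq_or_ne y 0 with rfl | hy0
    · rw [pairing_zero_right]
    · exact (hm y hy hy0).le
  intro hbot
  have h1 : AddMonoidAlgebra.single ⟨m, hmσ⟩ (1 : k) ∈ faceIdeal k h :=
    (single_mem_faceIdeal k h).2 fun h0 => (hm x (h hx) hx0).ne' (h0 x hx)
  rw [hbot, Ideal.mem_bot] at h1
  exact single_ne_zero k _ h1

theorem isNoetherianRing_coordRing (hσ : IsRational σ) : IsNoetherianRing (coordRing k σ) := by
  have := (AddMonoid.fg_iff_addSubmonoid_fg _).2 (fg_dualMonoid hσ)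
  exact Algebra.FiniteType.isNoetherianRing k _

/-- The torus orbit of a ray has codimension one. -/
theorem height_faceIdeal_of_coneDim_eq_one (hσ : IsRational σ) (hsc : ∀ x ∈ σ, -x ∈ σ → x = 0)
    (hdim : coneDim σ = 1) : (faceIdeal k (le_refl σ)).height = 1 := by
  have := isNoetherianRing_coordRing k hσ
  have hne : σ ≠ ⊥ := fun h => by rw [coneDim_eq_zero.2 h] at hdim; omega
  obtain ⟨m, hm⟩ := exists_pairing_pos hσ hsc
  have hmσ : m ∈ dualMonoid σ := fun y hy => by
    rcases eq_or_ne y 0 with rfl | hy0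
    · rw [pairing_zero_right]
    · exact (hm y hy hy0).le
  obtain ⟨x, hx, hx0⟩ := Submodule.exists_mem_ne_zero_of_ne_bot hne
  have h1 : AddMonoidAlgebra.single ⟨m, hmσ⟩ (1 : k) ∈ faceIdeal k (le_refl σ) :=
    (single_mem_faceIdeal k _).2 fun h0 => (hm x hx hx0).ne' (h0 x hx)
  have hmin : faceIdeal k (le_refl σ) ∈
      (Ideal.span {(AddMonoidAlgebra.single ⟨m, hmσ⟩ 1 : coordRing k σ)}).minimalPrimes := by
    refine ⟨⟨inferInstance, (Ideal.span_singleton_le_iff_mem _).2 h1⟩, fun 𝔮 h𝔮 _ => ?_⟩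
    have hprime : 𝔮.IsPrime := h𝔮.1
    refine faceIdeal_le k _ fun m' hm' => ?_
    -- the face cut out by `m'` is zero, so a multiple of `m'` exceeds `m`
    have hbot : faceOf σ m'.1 = ⊥ := by
      rw [← coneDim_eq_zero]
      have := coneDim_lt_of_isFace (isFace_faceOf m'.2) fun he => hm' fun y hy =>
        (mem_faceOf.1 (he.symm ▸ hy)).2
      omega
    obtain ⟨n, hn⟩ := exists_add_nsmul_mem hσ m'.2 (fun y => mem_faceOf)
      (u := -m) (by rw [hbot]; exact mem_dualMonoid_bot _)
    have hmul : (AddMonoidAlgebra.single m' 1 : coordRing k σ) ^ n =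
        AddMonoidAlgebra.single ⟨m, hmσ⟩ 1 * AddMonoidAlgebra.single ⟨_, hn n le_rfl⟩ 1 := by
      rw [AddMonoidAlgebra.single_pow, one_pow, AddMonoidAlgebra.single_mul_single, one_mul]
      congr 1
      exact Subtype.ext (add_neg_cancel_left m (n • m'.1)).symm
    refine hprime.mem_of_pow_mem n ?_
    rw [hmul]
    exact Ideal.mul_mem_right _ _ (h𝔮.2 (Ideal.mem_span_singleton_self _))
  refine le_antisymm (Ideal.height_le_one_of_isPrincipal_of_mem_minimalPrimes _ _ hmin) ?_
  rw [Order.one_le_iff_ne_zero, Ne, Ideal.height_eq_zero_iff_eq_bot]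
  exact faceIdeal_ne_bot k hσ hsc _ hne

/-- On a ray, a character has constant sign. -/
theorem mem_dualMonoid_or_neg_mem (hσ : IsRational σ) (hsc : ∀ x ∈ σ, -x ∈ σ → x = 0)
    (hdim : coneDim σ = 1) (m : Fin r → ℤ) : m ∈ dualMonoid σ ∨ -m ∈ dualMonoid σ := by
  obtain ⟨m', hm'⟩ := exists_pairing_pos hσ hsc
  have hne : σ ≠ ⊥ := fun h => by rw [coneDim_eq_zero.2 h] at hdim; omega
  obtain ⟨x, hx, hx0⟩ := Submodule.exists_mem_ne_zero_of_ne_bot hne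
  have key : ∀ y ∈ σ, ∃ c : ℝ, 0 ≤ c ∧ y = c • x := by
    intro y hy
    obtain ⟨c, hc⟩ := (finrank_eq_one_iff_of_nonzero'
      (⟨x, Submodule.subset_span hx⟩ : Submodule.span ℝ (σ : Set (Fin r → ℝ)))
      (fun h => hx0 (congrArg Subtype.val h))).1 hdim ⟨y, Submodule.subset_span hy⟩
    have hc' : c • x = y := congrArg Subtype.val hc
    refine ⟨c, ?_, hc'.symm⟩
    rcases eq_or_ne y 0 with rfl | hy0
    · exact ((smul_eq_zero.1 hc').resolve_right hx0).ge
    · have h1 := hm' y hy hy0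
      rw [← hc', pairing_smul_right] at h1
      exact (pos_of_mul_pos_left h1 (hm' x hx hx0).le).le
  rcases le_total 0 (pairing m x) with h | h
  · left
    intro y hy
    obtain ⟨c, hc, rfl⟩ := key y hy
    rw [pairing_smul_right]
    exact mul_nonneg hc h
  · right
    intro y hy
    obtain ⟨c, hc, rfl⟩ := key y hy
    rw [pairing_smul_right, pairing_neg_left]
    exact mul_nonneg hc (neg_nonneg.2 h)

end FaceIdeal

/-! ### The boundary of a toric variety -/

section Boundary

variable {Δ : ToricFan r}

/-- A point of `U_σ` in no smaller chart lies in the closed orbit of `U_σ`. -/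
theorem faceIdeal_le_of_notMem_range {σ : Δ.Cone} {y : PrimeSpectrum (coordRing k σ.1)}
    (hy : ∀ (τ : Δ.Cone) (h : τ.1 ≤ σ.1), τ ≠ σ → y ∉ Set.range (chartMap k h)) :
    faceIdeal k (le_refl σ.1) ≤ y.asIdeal := by
  refine faceIdeal_le k _ fun m hm => ?_
  have hf := isFace_faceOf m.2
  have h1 := hy ⟨faceOf σ.1 m.1, Δ.face_mem _ σ.2 _ hf⟩ hf.le fun he => hm fun x hx =>
    ((SetLike.ext_iff.1 (congrArg Subtype.val he) x).2 hx).2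
  rw [range_chartMap k (Δ.rational _ σ.2) hf.le m fun _ => mem_faceOf] at h1
  exact not_not.1 h1

/-- The generic point of the closed orbit of `U_σ` is in no smaller chart. -/
theorem notMem_range_chartMap {σ τ : Δ.Cone} {y : PrimeSpectrum (coordRing k σ.1)}
    (hy : faceIdeal k (le_refl σ.1) ≤ y.asIdeal) (h : τ.1 ≤ σ.1) (hne : τ ≠ σ) :
    y ∉ Set.range (chartMap k h) := by
  obtain ⟨m, hm, hτ⟩ := isFace_of_le (τ := τ) (σ := σ) h
  rw [range_chartMap k (Δ.rational _ σ.2) h ⟨m, hm⟩ hτ]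
  refine not_not.2 (hy ((single_mem_faceIdeal k _).2 fun h0 => hne (Subtype.ext ?_)))
  exact le_antisymm h fun x hx => (hτ x).2 ⟨hx, h0 x hx⟩

variable (Δ) in
/-- The rays `Δ(1)` of a fan. -/
abbrev Ray : Type := {σ : Δ.Cone // coneDim σ.1 = 1}

/-- The generic point of the prime divisor of a ray. -/
noncomputable def rayPoint (ρ : Δ.Ray) : Δ.variety k :=
  Δ.chartι k ρ.1 (⟨faceIdeal k (le_refl ρ.1.1), inferInstance⟩ : PrimeSpectrum (coordRing k ρ.1.1))

theorem height_faceIdeal_ray (ρ : Δ.Ray) : (faceIdeal k (le_refl ρ.1.1)).height = 1 :=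
  height_faceIdeal_of_coneDim_eq_one k (Δ.rational _ ρ.1.2) (Δ.stronglyConvex _ ρ.1.2) ρ.2

theorem coheight_rayPoint (ρ : Δ.Ray) : Order.coheight (rayPoint k ρ) = 1 :=
  (coheight_chart (Δ.chartι k ρ.1) ⟨faceIdeal k (le_refl ρ.1.1), inferInstance⟩).trans
    (height_faceIdeal_ray k ρ)

/-- The chart of the ray is the smallest one that contains the generic point of its divisor. -/
theorem le_of_rayPoint_eq_chartι {ρ : Δ.Ray} {σ : Δ.Cone} {y : Spec (CommRingCat.of (coordRing k σ.1))}
    (h : rayPoint k ρ = Δ.chartι k σ y) : ρ.1 ≤ σ := by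
  obtain ⟨κ, h1, h2, z, hz, -⟩ := (chartι_eq_iff k).1 h
  by_contra hle
  exact notMem_range_chartMap k le_rfl h1 (fun he => hle (he ▸ h2)) ⟨z, hz⟩

theorem rayPoint_injective : Function.Injective (rayPoint k : Δ.Ray → Δ.variety k) := fun _ _ h =>
  Subtype.ext (le_antisymm (le_of_rayPoint_eq_chartι k h) (le_of_rayPoint_eq_chartι k h.symm))

theorem rayPoint_notMem_range (ρ : Δ.Ray) : rayPoint k ρ ∉ Set.range (Δ.chartι k Δ.zeroCone) := by
  rintro ⟨y, hy⟩
  have h1 := eq_zeroCone_iff.1 (le_antisymm (le_of_rayPoint_eq_chartι k hy.symm) (zeroCone_le ρ.1))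
  have h2 := ρ.2
  omega

/-- The prime divisors outside of the torus are those of the rays. -/
theorem exists_rayPoint_eq {x : Δ.variety k} (hx : Order.coheight x = 1)
    (hx' : x ∉ Set.range (Δ.chartι k Δ.zeroCone)) : ∃ ρ : Δ.Ray, rayPoint k ρ = x := by
  obtain ⟨σ, ⟨y, hy⟩, hmin⟩ := (wellFounded_lt (α := Δ.Cone)).has_min
    {σ | x ∈ Set.range (Δ.chartι k σ)} (Δ.exists_chartι_eq k x)
  have hle : faceIdeal k (le_refl σ.1) ≤ (show PrimeSpectrum (coordRing k σ.1) from y).asIdeal := by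
    refine faceIdeal_le_of_notMem_range k fun τ h hne ⟨z, hz⟩ => ?_
    refine hmin τ ⟨z, ?_⟩ (lt_of_le_of_ne h hne)
    rw [← hy, ← hz, ← Scheme.Hom.comp_apply, chartMap_chartι k (τ := τ) (σ := σ) h]
  have hht : (show PrimeSpectrum (coordRing k σ.1) from y).asIdeal.height = 1 :=
    (coheight_chart (Δ.chartι k σ) y).symm.trans (by rw [hy]; exact hx)
  have hσ0 : coneDim σ.1 ≠ 0 := fun h0 => hx' (by
    rw [← eq_zeroCone_iff.2 h0]
    exact ⟨y, hy⟩)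
  have hrat := Δ.rational _ σ.2
  have hsc := Δ.stronglyConvex _ σ.2
  have hσ1 : coneDim σ.1 = 1 := by
    by_contra hσ1
    -- the ideal of an intermediate face lies strictly between zero and the ideal of `x`
    obtain ⟨τ, hτ, h1, h2⟩ := exists_face_between hrat (Δ.rational _ Δ.bot_mem)
      (isFace_bot hrat hsc) (by rw [coneDim_bot]; omega)
    have hlt : faceIdeal k h2.le < faceIdeal k (le_refl σ.1) := by
      refine lt_of_le_of_ne (faceIdeal_le k _ fun m hm => (single_mem_faceIdeal k _).2
        fun h0 => hm fun x hx => h0 x (h2.le hx)) fun he => ?_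
      obtain ⟨m, hm, hτm⟩ := hτ
      have h3 : AddMonoidAlgebra.single ⟨m, hm⟩ (1 : k) ∈ faceIdeal k (le_refl σ.1) :=
        (single_mem_faceIdeal k _).2 fun h0 =>
          h2.not_ge fun x hx => (hτm x).2 ⟨hx, h0 x hx⟩
      rw [← he, single_mem_faceIdeal] at h3
      exact h3 fun x hx => ((hτm x).1 hx).2
    have h4 := Ideal.height_add_one_le_of_lt_of_isPrime
      (bot_lt_iff_ne_bot.2 (faceIdeal_ne_bot k hrat hsc h2.le h1.ne'))
    have h5 := Ideal.height_add_one_le_of_lt_of_isPrime (hlt.trans_le hle)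
    rw [Ideal.height_bot, zero_add] at h4
    rw [hht] at h5
    have h6 : (1 + 1 : ℕ∞) ≤ 1 := (add_le_add_left h4 1).trans h5
    exact absurd h6 (by decide)
  refine ⟨⟨σ, hσ1⟩, ?_⟩
  have heq : faceIdeal k (le_refl σ.1) = (show PrimeSpectrum (coordRing k σ.1) from y).asIdeal := by
    by_contra hne
    have h5 := Ideal.height_add_one_le_of_lt_of_isPrime (lt_of_le_of_ne hle hne)
    rw [hht, height_faceIdeal_of_coneDim_eq_one k hrat hsc hσ1] at h5
    exact absurd h5 (by decide)
  rw [← hy]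
  exact congrArg (Δ.chartι k σ) (PrimeSpectrum.ext heq)

variable (Δ) in
/-- The character of `m ∈ M` as a rational function on the toric variety. -/
noncomputable def character (m : Fin r → ℤ) : (Δ.variety k).functionField :=
  Δ.toFunctionField k Δ.zeroCone (AddMonoidAlgebra.single ⟨m, mem_dualMonoid_bot m⟩ 1)

theorem character_ne_zero (m : Fin r → ℤ) : Δ.character k m ≠ 0 :=
  (map_ne_zero_iff _ (toFunctionField_injective k Δ.zeroCone)).2 (single_ne_zero k _)

theorem character_add (m n : Fin r → ℤ) :
    Δ.character k (m + n) = Δ.character k m * Δ.character k n := by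
  rw [character, character, character, ← map_mul, AddMonoidAlgebra.single_mul_single, one_mul]
  rfl

theorem character_eq (σ : Δ.Cone) (m : dualMonoid σ.1) :
    Δ.character k m.1 = Δ.toFunctionField k σ (AddMonoidAlgebra.single m 1) :=
  (congrArg (Δ.toFunctionField k Δ.zeroCone) (coordMap_single k (zeroCone_le σ) m 1)).symm.trans
    (toFunctionField_coordMap k (zeroCone_le σ) _)

theorem ord_character_of_mem (ρ : Δ.Ray) {m : Fin r → ℤ} (hm : m ∈ dualMonoid ρ.1.1) :
    Scheme.ord (Δ.character k m) (rayPoint k ρ) = 0 ↔ ∀ x ∈ ρ.1.1, pairing m x = 0 := by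
  have hc := character_eq k ρ.1 ⟨m, hm⟩
  refine ⟨fun h => ?_, fun h => ?_⟩
  · by_contra h0
    have h1 := ord_chart_pos_of_mem (Δ.chartι k ρ.1)
      ⟨faceIdeal k (le_refl ρ.1.1), inferInstance⟩ (height_faceIdeal_ray k ρ)
      (single_ne_zero k ⟨m, hm⟩) ((single_mem_faceIdeal k _).2 h0)
    exact h1.ne' (hc ▸ h)
  · have h1 := ord_chart_of_notMem (Δ.chartι k ρ.1)
      ⟨faceIdeal k (le_refl ρ.1.1), inferInstance⟩ (height_faceIdeal_ray k ρ)
      (a := AddMonoidAlgebra.single ⟨m, hm⟩ 1) (fun h1 => (single_mem_faceIdeal k _).1 h1 h)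
    exact hc ▸ h1

/-- A character has order zero along the divisor of a ray if and only if it is orthogonal to the
ray. -/
theorem ord_character_eq_zero_iff (ρ : Δ.Ray) (m : Fin r → ℤ) :
    Scheme.ord (Δ.character k m) (rayPoint k ρ) = 0 ↔ ∀ x ∈ ρ.1.1, pairing m x = 0 := by
  rcases mem_dualMonoid_or_neg_mem (Δ.rational _ ρ.1.2) (Δ.stronglyConvex _ ρ.1.2) ρ.2 m with h | h
  · exact ord_character_of_mem k ρ h
  · have h1 := ord_character_of_mem k ρ h
    have h2 := Scheme.ord_mul (x := rayPoint k ρ) (character_ne_zero k (Δ := Δ) m)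
      (character_ne_zero k (-m))
    have h3 := (ord_character_of_mem k ρ (zero_mem _)).2 fun x _ => pairing_zero_left x
    rw [← character_add, add_neg_cancel, h3] at h2
    simp only [pairing_neg_left, neg_eq_zero] at h1
    rw [← h1]
    omega

end Boundary

end ToricFan

namespace AlgebraicGeometry

/-! ### Divisors on a factorial chart -/

section FactorialChart

variable {X : Scheme.{u}} [IsIntegral X] [IsLocallyNoetherian X]

/-- The order of vanishing at a point, as a homomorphism on the nonzero rational functions. -/
noncomputable def ordUnits (x : X) : X.functionFieldˣ →* Multiplicative ℤ :=
  MonoidHom.mk' (fun f => Multiplicative.ofAdd (Scheme.ord (f : X.functionField) x))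
    fun f g => congrArg Multiplicative.ofAdd (Scheme.ord_mul f.ne_zero g.ne_zero)

theorem ord_zpow (x : X) (f : X.functionFieldˣ) (n : ℤ) :
    Scheme.ord ((f ^ n : X.functionFieldˣ) : X.functionField) x =
      n * Scheme.ord (f : X.functionField) x :=
  (congrArg Multiplicative.toAdd (map_zpow (ordUnits x) f n)).trans (smul_eq_mul _ _)

theorem ord_one (x : X) : Scheme.ord (1 : X.functionField) x = 0 :=
  congrArg Multiplicative.toAdd (map_one (ordUnits x))

variable {A : CommRingCat.{u}} (j : Spec A ⟶ X) [IsOpenImmersion j]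

theorem ord_chart_of_isUnit [Nonempty (Spec A)] {a : A} (ha : IsUnit a) {x : X}
    (hx : Order.coheight x = 1) (hxj : x ∈ Set.range j) :
    Scheme.ord (chartToFunctionField j a) x = 0 := by
  obtain ⟨y, rfl⟩ := hxj
  have hy := (coheight_chart j y).symm.trans hx
  exact ord_chart_of_notMem j y hy fun h => y.2.ne_top (Ideal.eq_top_of_isUnit_mem _ h ha)

variable [IsDomain A] [UniqueFactorizationMonoid A] [Nonempty (Spec A)]

/-- Every divisor is principal on a factorial chart. -/
theorem exists_ord_eq_on_chart (D : {x : X // Order.coheight x = 1} →₀ ℤ) :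
    ∃ f : X.functionFieldˣ, ∀ x, x.1 ∈ Set.range j →
      Scheme.ord (f : X.functionField) x.1 = D x := by
  induction D using Finsupp.induction_linear with
  | zero => exact ⟨1, fun x _ => ord_one x.1⟩
  | add D E hD hE =>
    obtain ⟨f, hf⟩ := hD
    obtain ⟨g, hg⟩ := hE
    refine ⟨f * g, fun x hx => ?_⟩
    rw [Units.val_mul, Scheme.ord_mul f.ne_zero g.ne_zero, hf x hx, hg x hx, Finsupp.add_apply]
  | single x n =>
    by_cases hx : x.1 ∈ Set.range j
    · obtain ⟨y, hy⟩ := hx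
      let y' : PrimeSpectrum A := y
      have hy1 : y'.asIdeal.height = 1 :=
        (coheight_chart j y').symm.trans ((congrArg Order.coheight hy).trans x.2)
      obtain ⟨p, hpy, hp⟩ := y'.2.exists_mem_prime_of_ne_bot (Ideal.ne_bot_of_height_eq_one hy1)
      have hspan := Ideal.eq_span_singleton_of_height_eq_one hy1 hpy hp
      have hp0 : chartToFunctionField j p ≠ 0 :=
        (map_ne_zero_iff _ (chartToFunctionField_injective j)).2 hp.ne_zero
      refine ⟨Units.mk0 _ hp0 ^ n, fun x' hx' => ?_⟩
      rw [ord_zpow, Units.val_mk0]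
      by_cases hxx : x = x'
      · subst hxx
        have h1 := ord_chart_of_eq_span j y' hy1 hp.ne_zero hspan
        rw [show j y' = x.1 from hy] at h1
        rw [h1, mul_one, Finsupp.single_eq_same]
      · obtain ⟨z, hz⟩ := hx'
        let z' : PrimeSpectrum A := z
        have hz1 : z'.asIdeal.height = 1 :=
          (coheight_chart j z').symm.trans ((congrArg Order.coheight hz).trans x'.2)
        have h1 := ord_chart_of_notMem j z' hz1 (a := p) fun hpz => hxx (Subtype.ext (by
          rw [← hy, ← hz]
          refine congrArg j (PrimeSpectrum.ext (x := y') (y := z') ?_)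
          rw [hspan, Ideal.eq_span_singleton_of_height_eq_one hz1 hpz hp]))
        rw [show j z' = x'.1 from hz] at h1
        rw [h1, mul_zero, Finsupp.single_eq_of_ne' hxx]
    · refine ⟨1, fun x' hx' => ?_⟩
      rw [Finsupp.single_eq_of_ne' fun h => hx (by rw [h]; exact hx')]
      exact ord_one x'.1

/-- A rational function without zeros and poles on a factorial chart is a unit there. -/
theorem exists_unit_of_ord_eq_zero_on_chart [IsNoetherianRing A] (f : X.functionFieldˣ)
    (hf : ∀ x : X, Order.coheight x = 1 → x ∈ Set.range j →
      Scheme.ord (f : X.functionField) x = 0) :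
    ∃ a : Aˣ, chartToFunctionField j a = f := by
  let := (chartToFunctionField j).toAlgebra
  have := isFractionRing_chartToFunctionField j
  obtain ⟨a, b, hab, hmk⟩ := IsFractionRing.exists_reduced_fraction (A := A) (f : X.functionField)
  have hfab : (f : X.functionField) * chartToFunctionField j b = chartToFunctionField j a :=
    IsLocalization.eq_mk'_iff_mul_eq.1 hmk.symm
  have hb0 : (b : A) ≠ 0 := nonZeroDivisors.coe_ne_zero b
  have hbK : chartToFunctionField j b ≠ 0 :=
    (map_ne_zero_iff _ (chartToFunctionField_injective j)).2 hb0
  have ha0 : a ≠ 0 := by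
    rintro rfl
    rw [map_zero] at hfab
    exact mul_ne_zero f.ne_zero hbK hfab
  -- a prime factor `p` gives a point at which `a` and `b` have the same order
  have key : ∀ p : A, Prime p → (p ∣ a ↔ p ∣ b) := by
    intro p hp
    have hprime : (Ideal.span {p}).IsPrime := (Ideal.span_singleton_prime hp.ne_zero).2 hp
    let y : PrimeSpectrum A := ⟨Ideal.span {p}, hprime⟩
    have hy : y.asIdeal.height = 1 :=
      Ideal.height_span_singleton_eq_one_of_mem_nonZeroDivisors
        (mem_nonZeroDivisors_of_ne_zero hp.ne_zero) hp.not_isUnit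
    have h1 := Scheme.ord_mul (x := j y) f.ne_zero hbK
    rw [hfab, hf _ ((coheight_chart j y).trans hy) ⟨y, rfl⟩, zero_add] at h1
    have hord : ∀ c : A, c ≠ 0 → (p ∣ c ↔ Scheme.ord (chartToFunctionField j c) (j y) ≠ 0) := by
      intro c hc
      rw [← Ideal.mem_span_singleton]
      refine ⟨fun h => (ord_chart_pos_of_mem j y hy hc h).ne', fun h => ?_⟩
      by_contra hn
      exact h (ord_chart_of_notMem j y hy hn)
    rw [hord a ha0, hord b hb0, h1]
  have hunit : ∀ c : A, c ≠ 0 → (∀ p : A, Prime p → p ∣ c → p ∣ a ∧ p ∣ b) → IsUnit c := by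
    intro c hc h
    by_contra hn
    obtain ⟨p, hp, hpc⟩ := WfDvdMonoid.exists_irreducible_factor hn hc
    obtain ⟨h1, h2⟩ := h p hp.prime hpc
    exact hp.not_isUnit (hab h1 h2)
  obtain ⟨a', ha'⟩ := hunit a ha0 fun p hp h => ⟨h, (key p hp).1 h⟩
  obtain ⟨b', hb'⟩ := hunit b hb0 fun p hp h => ⟨(key p hp).2 h, h⟩
  refine ⟨a' * b'⁻¹, mul_right_cancel₀ hbK ?_⟩
  rw [hfab, ← map_mul, ← ha', ← hb', Units.val_mul, mul_assoc, Units.inv_mul, mul_one]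

end FactorialChart

end AlgebraicGeometry

namespace ToricFan

variable {r : ℕ} (Δ : ToricFan r) (k : Type u) [Field k]

/-! ### The class group of a toric variety -/

section ClassGroup

instance : Finite Δ.Ray := inferInstanceAs (Finite {σ : Δ.Cone // coneDim σ.1 = 1})

/-- The prime divisor of a ray. -/
noncomputable def rayDivisor (ρ : Δ.Ray) : {x : Δ.variety k // Order.coheight x = 1} :=
  ⟨rayPoint k ρ, coheight_rayPoint k ρ⟩

theorem rayDivisor_injective : Function.Injective (Δ.rayDivisor k) := fun _ _ h =>
  rayPoint_injective k (congrArg Subtype.val h)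

/-- The divisor of a character, as a combination of the divisors of the rays. -/
noncomputable def characterDivisor : (Fin r → ℤ) →ₗ[ℤ] (Δ.Ray →₀ ℤ) :=
  AddMonoidHom.toIntLinearMap (AddMonoidHom.mk'
    (fun m => Finsupp.equivFunOnFinite.symm fun ρ =>
      Scheme.ord (Δ.character k m) (rayPoint k ρ))
    fun m n => Finsupp.ext fun ρ => by
      change Scheme.ord (Δ.character k (m + n)) _ = _
      rw [character_add, Scheme.ord_mul (character_ne_zero k m) (character_ne_zero k n)]
      rfl)

theorem characterDivisor_apply (m : Fin r → ℤ) (ρ : Δ.Ray) :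
    Δ.characterDivisor k m ρ = Scheme.ord (Δ.character k m) (rayPoint k ρ) := rfl

theorem ker_characterDivisor :
    LinearMap.ker (Δ.characterDivisor k) = Δ.orthogonalLattice := by
  ext m
  rw [LinearMap.mem_ker, mem_orthogonalLattice_iff_rays]
  refine ⟨fun h ρ hρ h1 => (ord_character_eq_zero_iff k ⟨⟨ρ, hρ⟩, h1⟩ m).1 (DFunLike.congr_fun h _),
    fun h => Finsupp.ext fun ρ => ?_⟩
  exact (ord_character_eq_zero_iff k ρ m).2 (h ρ.1.1 ρ.1.2 ρ.2)

/-- The class of a torus invariant divisor. -/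
noncomputable def rayClass : (Δ.Ray →₀ ℤ) →ₗ[ℤ] ClassGroup (Δ.variety k) :=
  (QuotientAddGroup.mk' (principalDivisors (Δ.variety k))).toIntLinearMap ∘ₗ
    Finsupp.lmapDomain ℤ ℤ (Δ.rayDivisor k)

theorem rayClass_apply (v : Δ.Ray →₀ ℤ) : Δ.rayClass k v =
    QuotientAddGroup.mk' (principalDivisors (Δ.variety k)) (v.mapDomain (Δ.rayDivisor k)) := rfl

theorem exists_rayDivisor_eq (x : {x : Δ.variety k // Order.coheight x = 1})
    (hx : x.1 ∉ Set.range (Δ.chartι k Δ.zeroCone)) : ∃ ρ, Δ.rayDivisor k ρ = x := by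
  obtain ⟨ρ, hρ⟩ := exists_rayPoint_eq k x.2 hx
  exact ⟨ρ, Subtype.ext hρ⟩

theorem mapDomain_rayDivisor_of_mem_range (v : Δ.Ray →₀ ℤ)
    {x : {x : Δ.variety k // Order.coheight x = 1}}
    (hx : x.1 ∈ Set.range (Δ.chartι k Δ.zeroCone)) : v.mapDomain (Δ.rayDivisor k) x = 0 := by
  refine Finsupp.mapDomain_of_notMem_range _ _ ?_
  rintro ⟨ρ, rfl⟩
  exact rayPoint_notMem_range k ρ hx

instance isDomain_torusRing : IsDomain (CommRingCat.of (coordRing k Δ.zeroCone.1)) :=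
  inferInstanceAs (IsDomain (coordRing k _))

instance uniqueFactorizationMonoid_torusRing :
    UniqueFactorizationMonoid (CommRingCat.of (coordRing k Δ.zeroCone.1)) :=
  inferInstanceAs (UniqueFactorizationMonoid (coordRing k (⊥ : PointedCone ℝ (Fin r → ℝ))))

instance isNoetherianRing_torusRing :
    IsNoetherianRing (CommRingCat.of (coordRing k Δ.zeroCone.1)) :=
  isNoetherianRing_coordRing k (Δ.rational _ Δ.zeroCone.2)

/-- As the torus has trivial class group, the class group of a toric variety is generated by the
divisors of the rays. -/
theorem rayClass_surjective : Function.Surjective (Δ.rayClass k) := by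
  intro q
  obtain ⟨D, rfl⟩ := QuotientAddGroup.mk'_surjective _ q
  obtain ⟨f, hf⟩ := exists_ord_eq_on_chart (Δ.chartι k Δ.zeroCone) D
  refine ⟨Finsupp.equivFunOnFinite.symm fun ρ => D (Δ.rayDivisor k ρ) -
    Scheme.ord (f : (Δ.variety k).functionField) (rayPoint k ρ), ?_⟩
  rw [rayClass_apply]
  refine (QuotientAddGroup.eq (s := principalDivisors (Δ.variety k))).2 ⟨f, f.ne_zero, fun x => ?_⟩
  rw [Finsupp.add_apply, Finsupp.neg_apply]
  by_cases hx : x.1 ∈ Set.range (Δ.chartι k Δ.zeroCone)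
  · rw [mapDomain_rayDivisor_of_mem_range Δ k _ hx, hf x hx, neg_zero, zero_add]
  · obtain ⟨ρ, rfl⟩ := Δ.exists_rayDivisor_eq k x hx
    rw [Finsupp.mapDomain_apply (Δ.rayDivisor_injective k)]
    change -(D (Δ.rayDivisor k ρ) - Scheme.ord (f : (Δ.variety k).functionField) (rayPoint k ρ)) +
      D (Δ.rayDivisor k ρ) = Scheme.ord (f : (Δ.variety k).functionField) (rayPoint k ρ)
    ring

theorem isUnit_single_bot (m : Fin r → ℤ) {c : k} (hc : c ≠ 0) :
    IsUnit (AddMonoidAlgebra.single ⟨m, mem_dualMonoid_bot m⟩ c :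
      coordRing k (⊥ : PointedCone ℝ (Fin r → ℝ))) := by
  refine IsUnit.of_mul_eq_one (AddMonoidAlgebra.single ⟨-m, mem_dualMonoid_bot (-m)⟩ c⁻¹) ?_
  rw [AddMonoidAlgebra.single_mul_single, mul_inv_cancel₀ hc, AddMonoidAlgebra.one_def]
  congr 1
  exact Subtype.ext (add_neg_cancel m)

/-- A rational function without zeros and poles on the torus is a multiple of a character, so it
has the same divisor as this character. -/
theorem exists_ord_eq_ord_character (f : (Δ.variety k).functionFieldˣ)
    (hf : ∀ x : Δ.variety k, Order.coheight x = 1 → x ∈ Set.range (Δ.chartι k Δ.zeroCone) →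
      Scheme.ord (f : (Δ.variety k).functionField) x = 0) :
    ∃ m : Fin r → ℤ, ∀ ρ : Δ.Ray, Scheme.ord (f : (Δ.variety k).functionField) (rayPoint k ρ) =
      Scheme.ord (Δ.character k m) (rayPoint k ρ) := by
  obtain ⟨a, ha⟩ := exists_unit_of_ord_eq_zero_on_chart (Δ.chartι k Δ.zeroCone) f hf
  obtain ⟨m, c, hc, hm, -⟩ := exists_eq_single_of_isUnit k (σ := Δ.zeroCone.1) a.isUnit
  refine ⟨m.1, fun ρ => ?_⟩
  have hcu : IsUnit (algebraMap k (coordRing k ρ.1.1) c) := (isUnit_iff_ne_zero.2 hc).map _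
  have h0 : Scheme.ord (Δ.toFunctionField k ρ.1 (algebraMap k _ c)) (rayPoint k ρ) = 0 :=
    ord_chart_of_isUnit (A := CommRingCat.of (coordRing k ρ.1.1)) (Δ.chartι k ρ.1) hcu
      (coheight_rayPoint k ρ) ⟨_, rfl⟩
  have hfc : (f : (Δ.variety k).functionField) =
      Δ.toFunctionField k ρ.1 (algebraMap k _ c) * Δ.character k m.1 := by
    have h1 : Δ.toFunctionField k ρ.1 (algebraMap k _ c) =
        Δ.toFunctionField k Δ.zeroCone (algebraMap k _ c) :=
      (toFunctionField_coordMap k (zeroCone_le ρ.1) _).symm.trans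
        (congrArg (Δ.toFunctionField k Δ.zeroCone)
          (RingHom.congr_fun (coordMap_comp_algebraMap k (zeroCone_le ρ.1)) c))
    rw [h1, ← ha, character, ← map_mul, hm]
    refine congrArg (Δ.toFunctionField k Δ.zeroCone) ?_
    rw [AddMonoidAlgebra.coe_algebraMap, Function.comp_apply, AddMonoidAlgebra.single_mul_single,
      zero_add, Algebra.algebraMap_self, RingHom.id_apply, mul_one]
  rw [hfc, Scheme.ord_mul ((map_ne_zero_iff _ (toFunctionField_injective k ρ.1)).2 hcu.ne_zero)
    (character_ne_zero k m.1), h0, zero_add]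

/-- The relations between the classes of the rays are the divisors of the characters. -/
theorem ker_rayClass : LinearMap.ker (Δ.rayClass k) = LinearMap.range (Δ.characterDivisor k) := by
  ext v
  rw [LinearMap.mem_ker, rayClass_apply]
  refine (QuotientAddGroup.eq_zero_iff (N := principalDivisors (Δ.variety k)) _).trans ⟨?_, ?_⟩
  · rintro ⟨f, hf0, hf⟩
    obtain ⟨m, hm⟩ := Δ.exists_ord_eq_ord_character k (Units.mk0 f hf0) fun x hx hxT => by
      rw [Units.val_mk0, ← hf ⟨x, hx⟩, mapDomain_rayDivisor_of_mem_range Δ k _ hxT]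
    refine ⟨m, Finsupp.ext fun ρ => ?_⟩
    rw [characterDivisor_apply, ← hm ρ, Units.val_mk0]
    exact (hf (Δ.rayDivisor k ρ)).symm.trans
      (Finsupp.mapDomain_apply (Δ.rayDivisor_injective k) _ _)
  · rintro ⟨m, rfl⟩
    refine ⟨Δ.character k m, character_ne_zero k m, fun x => ?_⟩
    by_cases hx : x.1 ∈ Set.range (Δ.chartι k Δ.zeroCone)
    · rw [mapDomain_rayDivisor_of_mem_range Δ k _ hx]
      exact (ord_chart_of_isUnit (Δ.chartι k Δ.zeroCone) (isUnit_single_bot k m one_ne_zero)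
        x.2 hx).symm
    · obtain ⟨ρ, rfl⟩ := Δ.exists_rayDivisor_eq k x hx
      rw [Finsupp.mapDomain_apply (Δ.rayDivisor_injective k)]
      rfl

theorem finite_classGroupQ_and_rho1'_add_spanDim :
    Module.Finite ℚ (Δ.classGroupQ k) ∧ Δ.rho1' k + Δ.spanDim = Δ.numRays := by
  have := Fintype.ofFinite Δ.Ray
  have hfin : Module.Finite ℤ (ClassGroup (Δ.variety k)) :=
    Module.Finite.of_surjective _ (Δ.rayClass_surjective k)
  obtain ⟨h1, h2⟩ := finite_and_finrank_rat_tensor (M := ClassGroup (Δ.variety k))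
  refine ⟨h1, ?_⟩
  have h3 := (LinearMap.quotKerEquivOfSurjective _
    (LinearMap.range_eq_top.1 (LinearMap.range_eq_top.2 (Δ.rayClass_surjective k)))).finrank_eq
  have h4 := (LinearMap.ker (Δ.rayClass k)).finrank_quotient_add_finrank
  have h5 := (Δ.characterDivisor k).quotKerEquivRange.finrank_eq
  have h6 := (LinearMap.ker (Δ.characterDivisor k)).finrank_quotient_add_finrank
  have h7 := Δ.finrank_orthogonalLattice_add_spanDim
  rw [ker_rayClass] at h3 h4
  rw [ker_characterDivisor] at h5 h6
  rw [Module.finrank_fin_fun] at h6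
  rw [Module.finrank_finsupp_self, ← Nat.card_eq_fintype_card, ← numRays_eq_card] at h4
  rw [rho1', h2]
  omega

end ClassGroup

end ToricFan

theorem theorem3p1 (r : ℕ) (k : Type u) [Field k] (k' : Type v) [Field k'] :
    -- (a) `ρ₀` is finite, equal to `r - s`; it is a fan invariant, not a topological invariant
    ((∀ Δ : ToricFan r, Module.Finite ℚ (Δ.unitsQ k) ∧ (Δ.rho0 k : ℤ) = r - Δ.spanDim) ∧
      (∀ Δ : ToricFan r, Δ.rho0 k = Δ.rho0 k') ∧
      (2 ≤ r → ¬ ToricFan.IsTopologicalInvariant (fun Δ : ToricFan r => Δ.rho0 k))) ∧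
    -- (b) fans with a cone of dimension `r`, for example complete fans
    ((∀ Δ : ToricFan r, Δ.IsComplete → ∃ σ ∈ Δ.cones, ToricFan.coneDim σ = r) ∧
      (∀ Δ : ToricFan r, (∃ σ ∈ Δ.cones, ToricFan.coneDim σ = r) →
        Δ.rho0 k = 0 ∧ ToricFan.IsTopologicalInvariantOf (fun Δ : ToricFan r => Δ.rho0 k) Δ)) ∧
    -- (c) `ρ₁'` is finite, equal to `#Δ(1) - s`; it is a topological invariant if `dim Δ_top = r`
    ((∀ Δ : ToricFan r,
        Module.Finite ℚ (Δ.classGroupQ k) ∧ (Δ.rho1' k : ℤ) = Δ.numRays - Δ.spanDim) ∧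
      (∀ Δ : ToricFan r, topologicalKrullDim Δ.Cone = r →
        ToricFan.IsTopologicalInvariantOf (fun Δ : ToricFan r => Δ.rho1' k) Δ)) ∧
    -- (d) `ρ₀ - ρ₁'` is a topological invariant
    ((∀ Δ : ToricFan r, (Δ.rho0 k : ℤ) - Δ.rho1' k = r - Δ.numRays) ∧
      ToricFan.IsTopologicalInvariant (fun Δ : ToricFan r => (Δ.rho0 k : ℤ) - Δ.rho1' k)) := by
  have h0 := fun Δ : ToricFan r => (Δ.finite_unitsQ_and_rho0_add_spanDim k).2
  have h0' := fun Δ : ToricFan r => (Δ.finite_unitsQ_and_rho0_add_spanDim k').2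
  have h1 := fun Δ : ToricFan r => (Δ.finite_classGroupQ_and_rho1'_add_spanDim k).2
  refine ⟨⟨fun Δ => ⟨(Δ.finite_unitsQ_and_rho0_add_spanDim k).1, ?_⟩, fun Δ => ?_, fun hr h => ?_⟩,
    ⟨fun Δ h => h.exists_coneDim_eq, fun Δ h => ⟨?_, fun Δ' ⟨e⟩ => ?_⟩⟩,
    ⟨fun Δ => ⟨(Δ.finite_classGroupQ_and_rho1'_add_spanDim k).1, ?_⟩, fun Δ h Δ' ⟨e⟩ => ?_⟩,
    fun Δ => ?_, fun Δ Δ' ⟨e⟩ => ?_⟩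
  · have := h0 Δ
    omega
  · have := h0 Δ
    have := h0' Δ
    omega
  · obtain ⟨Δ, Δ', he, hlt⟩ := ToricFan.exists_homeomorph_spanDim_ne hr
    have h2 : Δ'.rho0 k = Δ.rho0 k := h Δ Δ' he
    have := h0 Δ
    have := h0 Δ'
    omega
  · have := h0 Δ
    have := ToricFan.spanDim_eq_of_exists h
    omega
  · have := h0 Δ
    have := h0 Δ'
    have := ToricFan.spanDim_eq_of_exists h
    have := ToricFan.spanDim_eq_of_exists (ToricFan.exists_coneDim_eq_of_homeomorph e h)
    change Δ'.rho0 k = Δ.rho0 k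
    omega
  · have := h1 Δ
    omega
  · have h2 := ToricFan.exists_coneDim_eq_of_topologicalKrullDim h
    have := h1 Δ
    have := h1 Δ'
    have := ToricFan.spanDim_eq_of_exists h2
    have := ToricFan.spanDim_eq_of_exists (ToricFan.exists_coneDim_eq_of_homeomorph e h2)
    have := ToricFan.numRays_eq_of_homeomorph e
    change Δ'.rho1' k = Δ.rho1' k
    omega
  · have := h0 Δ
    have := h1 Δ
    omega
  · have := h0 Δ
    have := h1 Δ
    have := h0 Δ'
    have := h1 Δ'
    have := ToricFan.numRays_eq_of_homeomorph e
    change (Δ'.rho0 k : ℤ) - Δ'.rho1' k = Δ.rho0 k - Δ.rho1' k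
    omega
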